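/- Let $0<a\le 2$ and let $\varphi:[0,\infty)\to\mathbb R$ be increasing with $\varphi(r)=r^a$ for $r>1$. Assume that the radial extension $\varphi(z)=\varphi(|z|)$ is $C^2$ on $\mathbb C$ with $\Delta\varphi>0$, put $\rho(z)=(\Delta\varphi(z))^{-1/2}$, and assume that for every fixed $C$ one has $\rho(x+C\rho(x))\asymp\rho(x)$, $0<x<\infty$. (Then $\rho(x)\asymp x^{1-a/2}$ for $x>1$.) Here $A\asymp B$ means that each of $A,B$ is bounded by a constant times the other. For a weight $\psi$ on $[0,\infty)$ put $$\|g\|_\psi^2=\int_{\mathbb C}|g(z)|^2e^{-2\psi(|z|)}\,dm(z)\in[0,\infty],$$ where $m$ is area measure, and let $\mathcal F^2_\varphi$ be the space of entire functions $f$ with $\|f\|_\varphi<\infty$. For $\beta\ge 0$ put $\varphi_\beta(r)=\varphi(r)+\beta\log(1+r)$. For $\gamma\in\mathbb R$ let $\mathcal S_\gamma$ be the class of entire functions $S$ with zero set $\Lambda$ such that $$\inf_{\lambda\ne\lambda^*;\ \lambda,\lambda^*\in\Lambda}\frac{|\lambda-\lambda^*|}{\min(\rho(\lambda),\rho(\lambda^*))}>0\qquad\text{and}\qquad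 |S(z)|\asymp e^{\varphi(z)}\,\frac{d(z,\Lambda)}{\rho(z)}\,\frac1{(1+|z|)^{\gamma}},\quad z\in\mathbb C,$$ where $d(z,\Lambda)$ is the Euclidean distance from $z$ to $\Lambda$. Let $0\le\beta<a/4$, $\gamma\in\mathbb R$ and $S\in\mathcal S_\gamma$, and let $\lambda_1,\lambda_2,\dots$ be the zeros of $S$, each listed once, ordered so that $|\lambda_k|\le|\lambda_{k+1}|$ for all $k\ge1$. Then there exists $f\in\mathcal F^2_\varphi$ such that $$\Bigl\|f-S\sum_{k=1}^{N}\frac{f(\lambda_k)}{S'(\lambda_k)(\cdot-\lambda_k)}\Bigr\|_{\varphi_\beta}\not\to0,\qquad N\to\infty.$$ -/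

import Mathlib

open Real Set Filter Topology MeasureTheory
open scoped ENNReal

noncomputable section

namespace Fock

/-- `A ≍ B` on the set `s`: each function is at most a constant multiple of the other on `s`. -/
def Comparable {α : Type*} (s : Set α) (A B : α → ℝ) : Prop :=
  ∃ C : ℝ, 0 < C ∧ ∀ x ∈ s, A x ≤ C * B x ∧ B x ≤ C * A x

/-- The radial extension of `φ` to the plane, `z ↦ φ(|z|)`. -/
def radial (φ : ℝ → ℝ) (z : ℂ) : ℝ := φ ‖z‖

/-- The Laplacian `Δu` of a real function on the plane. -/
def lap (u : ℂ → ℝ) : ℂ → ℝ := Laplacian.laplacian u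

/-- `ρ(z) = (Δφ(z))^{-1/2}`. -/
def rho (φ : ℝ → ℝ) (z : ℂ) : ℝ := (lap (radial φ) z) ^ (-(1 / 2) : ℝ)

/-- The standing assumptions on the weight. Only the values of `φ` on `[0, ∞)` matter.
For a `C²` function, subharmonicity is nonnegativity of the Laplacian; it is required to be
positive so that `ρ` is everywhere finite. -/
structure IsWeight (φ : ℝ → ℝ) : Prop where
  monotoneOn : MonotoneOn φ (Ici 0)
  tendsto_atTop : Tendsto φ atTop atTop
  contDiff : ContDiff ℝ 2 (radial φ)
  laplacian_pos : ∀ z : ℂ, 0 < lap (radial φ) z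
  rho_comparable : ∀ C : ℝ, Comparable (Ioi (0 : ℝ))
    (fun x => rho φ ((x + C * rho φ (x : ℂ) : ℝ) : ℂ)) (fun x => rho φ (x : ℂ))

/-- The norm `‖g‖_φ = (∫ |g(z)|² e^{-2φ(|z|)} dm(z))^{1/2}` with respect to area measure,
with the value `∞` when the integral diverges. -/
def weightedNorm (φ : ℝ → ℝ) (g : ℂ → ℂ) : ℝ≥0∞ :=
  (∫⁻ z : ℂ, ‖g z‖ₑ ^ 2 * ENNReal.ofReal (Real.exp (-2 * φ ‖z‖))) ^ (1 / 2 : ℝ)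

/-- The weighted Fock space: entire functions of finite norm. -/
def space (φ : ℝ → ℝ) : Set (ℂ → ℂ) :=
  {f | Differentiable ℂ f ∧ weightedNorm φ f < ∞}

/-- `φ_β(r) = φ(r) + β log(1 + r)`. -/
def modify (φ : ℝ → ℝ) (β : ℝ) (r : ℝ) : ℝ := φ r + β * Real.log (1 + r)

/-- `d_ρ(z, w) = |z - w| / min(ρ(z), ρ(w))`. -/
def dRho (φ : ℝ → ℝ) (z w : ℂ) : ℝ := ‖z - w‖ / min (rho φ z) (rho φ w)

/-- `d_ρ`-separated sets: the `d_ρ`-distances of distinct points are bounded away from `0`. -/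
def Separated (φ : ℝ → ℝ) (Λ : Set ℂ) : Prop :=
  ∃ δ : ℝ, 0 < δ ∧ ∀ z ∈ Λ, ∀ w ∈ Λ, z ≠ w → δ ≤ dRho φ z w

/-- The zero set of a function. -/
def zeroSet (S : ℂ → ℂ) : Set ℂ := {z | S z = 0}

/-- The class `𝒮_γ` of entire functions whose zero set `Λ` is `d_ρ`-separated and for which
`|S(z)| ≍ e^{φ(z)} (d(z, Λ) / ρ(z)) (1 + |z|)^{-γ}` on the plane. -/
structure SineClass (φ : ℝ → ℝ) (γ : ℝ) (S : ℂ → ℂ) : Prop where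
  entire : Differentiable ℂ S
  separated : Separated φ (zeroSet S)
  comparable : Comparable (univ : Set ℂ) (fun z => ‖S z‖)
    (fun z => Real.exp (φ ‖z‖) * (Metric.infDist z (zeroSet S) / rho φ z)
      * (1 / (1 + ‖z‖) ^ γ))

/-- `l 0, l 1, …` lists the points of `Λ`, each of them once, in the order of nondecreasing
modulus. -/
structure IsOrdering (Λ : Set ℂ) (l : ℕ → ℂ) : Prop where
  injective : Function.Injective l
  range_eq : Set.range l = Λ
  norm_monotone : Monotone (fun k => ‖l k‖)

/-- The sum of the first `N` terms of the Lagrange interpolation series of `f`: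
`S(z) ∑ f(λ_k) / (S'(λ_k) (z - λ_k))`. (Its values at the finitely many points `z = λ_k` in the
sum are immaterial, as only its weighted `L²` norm is used.) -/
def lagrangeSum (S : ℂ → ℂ) (l : ℕ → ℂ) (f : ℂ → ℂ) (N : ℕ) (z : ℂ) : ℂ :=
  S z * ∑ k ∈ Finset.range N, f (l k) / (deriv S (l k) * (z - l k))

end Fock

end

/-!
Suppose that the interpolation series converged for every `f`. Then the differences of its partial
sums, `S(z) ∑ f(λ_k) / (S'(λ_k) (z - λ_k))` with `k` running over the zeros in an annulus, would be
bounded in the norm of `φ_β` for each `f`. This fails because the terms coming from a single annulus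
of width comparable with `ρ` can add up without cancellation.

Put `T = R^{a/2}`, so that `ρ(R) ≍ R / T` and at most `O(T)` separated zeros fit in an annulus
`R ≤ |λ| ≤ R + ε ρ(R)`. There is a function `F` of norm `O(1)` in the Fock space, concentrated near
this annulus, for which all the numbers `F(λ) / S'(λ)`, `λ` a zero in the annulus, are almost
positive and of size `R^γ T^{-1/2}` (`Fock.exists_peak_functions`). It is a sum over these zeros of
`c_λ z^n (∑_{j<m} (z/λ)^j)^3`, with `n ≈ a R^a` and `m = T / ε`: the monomial `z^n` localises to the
annulus, the kernel localises along the circle, the phase `c_λ` is free, and the off-diagonal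
contribution is a small fraction of the diagonal one if `ε` is small, since `|λ - λ'|^{-3}` is
summable over separated sets.

If the annulus contains about `T^{1-τ}` zeros, then on `4R < |z| < 5R` the corresponding block of the
series has size `|S(z)| R^{γ-1} T^{1/2-τ}`. On most of this region `|S| ≳ e^φ R^{-γ}`, so the norm of
the block in the weight `φ_β` is at least of order `R^{-β} T^{1/2-τ} = R^{a/4-β-τa/2}`, which is
unbounded when `β < a / 4` and `τ` is small. Such annuli exist for arbitrarily large `R`
(`Fock.SineClass.frequently_le_ncard_annulus`): by Jensen's formula on circles that avoid the zeros,
the number of zeros of modulus at most `X` is not `O(X^κ)` for any `κ < a`.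

To pass from these functions `F`, which vary with the annulus, to a single `f`, the norm of the block
is replaced by a linear functional that it dominates, the integral of `z ∑ f(λ_k) / (S'(λ_k) (z - λ_k))`
over the part of `4R < |z| < 5R` away from the zeros, and the Banach–Steinhaus theorem is applied to
sums `∑ c_j F_j` with absolutely summable coefficients (`Fock.exists_mem_space_unbounded`).
-/

/-! ### Explicit form of the weight outside the unit disc -/

namespace Fock

theorem hasFDerivAt_rpow_sq_add_sq {b : ℝ} {z : ℂ} (hz : z ≠ 0) :
    HasFDerivAt (fun w : ℂ => (w.re ^ 2 + w.im ^ 2) ^ b)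
      ((2 * b * (z.re ^ 2 + z.im ^ 2) ^ (b - 1) * z.re) • Complex.reCLM +
        (2 * b * (z.re ^ 2 + z.im ^ 2) ^ (b - 1) * z.im) • Complex.imCLM) z := by
  have hre : HasFDerivAt (fun w : ℂ => w.re) Complex.reCLM z := Complex.reCLM.hasFDerivAt
  have him : HasFDerivAt (fun w : ℂ => w.im) Complex.imCLM z := Complex.imCLM.hasFDerivAt
  have hpos : z.re ^ 2 + z.im ^ 2 ≠ 0 := by
    have := Complex.normSq_pos.2 hz
    rw [Complex.normSq_apply] at this
    nlinarith
  have h := ((hre.pow 2).add (him.pow 2)).rpow_const (p := b) (Or.inl hpos)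
  refine HasFDerivAt.congr_fderiv (f' := _) h ?_
  ext v
  · simp
    ring

theorem lap_norm_rpow {a : ℝ} {z : ℂ} (hz : z ≠ 0) :
    Laplacian.laplacian (fun w : ℂ => (w.re ^ 2 + w.im ^ 2) ^ (a / 2)) z = a ^ 2 * ‖z‖ ^ (a - 2) := by
  have hu : 0 < z.re ^ 2 + z.im ^ 2 := by
    have := Complex.normSq_pos.2 hz
    rw [Complex.normSq_apply] at this
    nlinarith
  set b := a / 2 with hb
  set G : ℂ → ℂ →L[ℝ] ℝ := fun w =>
    (2 * b * (w.re ^ 2 + w.im ^ 2) ^ (b - 1) * w.re) • Complex.reCLM +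
        (2 * b * (w.re ^ 2 + w.im ^ 2) ^ (b - 1) * w.im) • Complex.imCLM with hG
  have hfG : fderiv ℝ (fun w : ℂ => (w.re ^ 2 + w.im ^ 2) ^ b) =ᶠ[𝓝 z] G := by
    filter_upwards [isOpen_ne.mem_nhds hz] with w hw
    exact (hasFDerivAt_rpow_sq_add_sq hw).fderiv
  have hre : HasFDerivAt (fun w : ℂ => w.re) Complex.reCLM z := Complex.reCLM.hasFDerivAt
  have him : HasFDerivAt (fun w : ℂ => w.im) Complex.imCLM z := Complex.imCLM.hasFDerivAt
  have h1 := (hasFDerivAt_rpow_sq_add_sq (b := b - 1) hz).const_mul (2 * b)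
  have hGd := ((h1.mul hre).smul_const Complex.reCLM).add ((h1.mul him).smul_const Complex.imCLM)
  have hGe : fderiv ℝ (fderiv ℝ (fun w : ℂ => (w.re ^ 2 + w.im ^ 2) ^ b)) z = _ :=
    (hfG.fderiv_eq).trans hGd.fderiv
  rw [InnerProductSpace.laplacian_eq_iteratedFDeriv_complexPlane]
  simp only [iteratedFDeriv_two_apply, hGe]
  simp
  have e1 : (z.re ^ 2 + z.im ^ 2) ^ (b - 1) = (z.re ^ 2 + z.im ^ 2) * (z.re ^ 2 + z.im ^ 2) ^ (b - 1 - 1) := by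
    rw [Real.rpow_sub_one hu.ne' (b - 1)]
    field_simp
  have e2 : ‖z‖ ^ (a - 2) = (z.re ^ 2 + z.im ^ 2) ^ (b - 1) := by
    rw [Complex.norm_eq_sqrt_sq_add_sq, Real.sqrt_eq_rpow, ← Real.rpow_mul hu.le]
    congr 1; rw [hb]; ring
  rw [e2, e1]
  have : a = 2 * b := by rw [hb]; ring
  rw [this]
  ring

theorem continuous_lap {u : ℂ → ℝ} (hu : ContDiff ℝ 2 u) : Continuous (lap u) := by
  unfold lap
  rw [InnerProductSpace.laplacian_eq_iteratedFDeriv_complexPlane]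
  have h : Continuous (iteratedFDeriv ℝ 2 u) := hu.continuous_iteratedFDeriv le_rfl
  fun_prop

section Weight

variable {a : ℝ} {φ : ℝ → ℝ}

theorem lap_radial_of_one_lt (hpow : ∀ r : ℝ, 1 < r → φ r = r ^ a) {z : ℂ} (hz : 1 < ‖z‖) :
    lap (radial φ) z = a ^ 2 * ‖z‖ ^ (a - 2) := by
  have hz0 : z ≠ 0 := by
    rintro rfl
    simp at hz
    linarith
  rw [← lap_norm_rpow hz0]
  have : radial φ =ᶠ[𝓝 z] fun w : ℂ => (w.re ^ 2 + w.im ^ 2) ^ (a / 2) := by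
    filter_upwards [(isOpen_lt continuous_const continuous_norm).mem_nhds hz] with w hw
    rw [radial, hpow _ hw, Complex.norm_eq_sqrt_sq_add_sq, Real.sqrt_eq_rpow,
      ← Real.rpow_mul (by positivity)]
    congr 1; ring
  exact (InnerProductSpace.laplacian_congr_nhds this).self_of_nhds

theorem rho_of_one_lt (ha : 0 < a) (hpow : ∀ r : ℝ, 1 < r → φ r = r ^ a) {z : ℂ}
    (hz : 1 < ‖z‖) : rho φ z = ‖z‖ ^ (1 - a / 2) / a := by
  have h0 : (0 : ℝ) ≤ ‖z‖ := norm_nonneg z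
  rw [rho, lap_radial_of_one_lt hpow hz, Real.mul_rpow (by positivity) (by positivity),
    ← Real.rpow_mul h0, ← Real.rpow_natCast, ← Real.rpow_mul ha.le]
  rw [show (((2 : ℕ) : ℝ) * -(1 / 2)) = -1 by norm_num, Real.rpow_neg_one,
    show (a - 2) * -(1 / 2) = 1 - a / 2 by ring]
  field_simp

theorem rho_pos (hφ : IsWeight φ) (z : ℂ) : 0 < rho φ z :=
  Real.rpow_pos_of_pos (hφ.laplacian_pos z) _

theorem continuous_rho (hφ : IsWeight φ) : Continuous (rho φ) := by
  unfold rho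
  exact (continuous_lap hφ.contDiff).rpow_const fun z => Or.inl (hφ.laplacian_pos z).ne'

/-- Up to a constant, `e^{-φ}` is dominated by `e^{-r^a}` on the whole half-line. -/
theorem exists_exp_neg_le (ha : 0 < a) (hφ : IsWeight φ) (hpow : ∀ r : ℝ, 1 < r → φ r = r ^ a) :
    ∃ C : ℝ, 0 < C ∧ ∀ r : ℝ, 0 ≤ r → Real.exp (-φ r) ≤ C * Real.exp (-r ^ a) := by
  refine ⟨Real.exp (1 + |φ 0|), Real.exp_pos _, fun r hr => ?_⟩
  rw [← Real.exp_add]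
  apply Real.exp_le_exp.2
  rcases lt_or_ge 1 r with h | h
  · rw [hpow r h]
    have := abs_nonneg (φ 0)
    linarith
  · have h1 : φ 0 ≤ φ r := hφ.monotoneOn (by simp) (by simpa using hr) hr
    have h2 : r ^ a ≤ 1 := Real.rpow_le_one hr h ha.le
    have h3 := neg_abs_le (φ 0)
    linarith

end Weight

end Fock

/-! ### Sums over separated families of points -/

namespace Fock

/-- A finite family of points of the plane with mutual distances at least `s`. -/
def SepFamily (A : Finset ℕ) (x : ℕ → ℂ) (s : ℝ) : Prop :=
  ∀ i ∈ A, ∀ j ∈ A, i ≠ j → s ≤ ‖x i - x j‖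

theorem SepFamily.pairwiseDisjoint_ball {A : Finset ℕ} {x : ℕ → ℂ} {s : ℝ}
    (h : SepFamily A x s) : (A : Set ℕ).PairwiseDisjoint fun i => Metric.ball (x i) (s / 2) := by
  intro i hi j hj hij
  apply Metric.ball_disjoint_ball
  rw [dist_eq_norm]
  linarith [h i hi j hj hij]

theorem volume_real_ball (z : ℂ) {r : ℝ} (hr : 0 ≤ r) :
    volume.real (Metric.ball z r) = r ^ 2 * π := by
  rw [Measure.real, Complex.volume_ball]
  simp [hr]

theorem volume_real_closedBall (z : ℂ) {r : ℝ} (hr : 0 ≤ r) :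
    volume.real (Metric.closedBall z r) = r ^ 2 * π := by
  rw [Measure.real, Complex.volume_closedBall]
  simp [hr]

theorem SepFamily.card_mul_sq_le {A : Finset ℕ} {x : ℕ → ℂ} {s r : ℝ} (hs : 0 < s)
    (h : SepFamily A x s) (hr : 0 ≤ r) (hx : ∀ i ∈ A, ‖x i‖ ≤ r) :
    (A.card : ℝ) * s ^ 2 ≤ (2 * r + s) ^ 2 := by
  have h1 : volume.real (⋃ i ∈ A, Metric.ball (x i) (s / 2)) =
      ∑ i ∈ A, volume.real (Metric.ball (x i) (s / 2)) :=
    measureReal_biUnion_finset h.pairwiseDisjoint_ball (fun i _ => measurableSet_ball)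
      (fun i _ => by rw [Complex.volume_ball]; exact ENNReal.mul_ne_top (by simp) (by simp))
  have h2 : (⋃ i ∈ A, Metric.ball (x i) (s / 2)) ⊆ Metric.ball 0 (r + s / 2) := by
    intro w hw
    simp only [mem_iUnion, Metric.mem_ball, dist_eq_norm] at hw ⊢
    obtain ⟨i, hi, hw⟩ := hw
    have := norm_add_le (w - x i) (x i)
    simp only [sub_add_cancel] at this
    have := hx i hi
    rw [sub_zero]
    linarith
  have h3 := measureReal_mono (μ := volume) h2
    (by rw [Complex.volume_ball]; exact ENNReal.mul_ne_top (by simp) (by simp))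
  rw [h1, volume_real_ball _ (by positivity)] at h3
  simp only [volume_real_ball _ (half_pos hs).le, Finset.sum_const, nsmul_eq_mul] at h3
  have hpi := Real.pi_pos
  have : (A.card : ℝ) * (s / 2) ^ 2 ≤ (r + s / 2) ^ 2 :=
    le_of_mul_le_mul_right (by linarith) hpi
  nlinarith

theorem integrable_inv_one_add_norm_cube : Integrable fun w : ℂ => ((1 + ‖w‖) ^ 3)⁻¹ := by
  have h := integrable_one_add_norm (E := ℂ) (μ := volume) (r := 3)
    (by rw [Complex.finrank_real_complex]; norm_num)
  refine h.congr (Eventually.of_forall fun w => ?_)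
  have : (0 : ℝ) ≤ 1 + ‖w‖ := by positivity
  simp only
  rw [Real.rpow_neg this]
  norm_cast

theorem SepFamily.sum_inv_cube_le_of_one {A : Finset ℕ} {x : ℕ → ℂ} (h : SepFamily A x 1) (z : ℂ) :
    ∑ i ∈ A, ((1 + ‖z - x i‖) ^ 3)⁻¹ ≤ 16 / π * ∫ w : ℂ, ((1 + ‖w‖) ^ 3)⁻¹ := by
  set f : ℂ → ℝ := fun w => ((1 + ‖z - w‖) ^ 3)⁻¹ with hf
  have hfi : Integrable f := integrable_inv_one_add_norm_cube.comp_sub_left z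
  have hI : ∫ w, f w = ∫ w : ℂ, ((1 + ‖w‖) ^ 3)⁻¹ :=
    integral_sub_left_eq_self (fun w : ℂ => ((1 + ‖w‖) ^ 3)⁻¹) volume z
  have hf0 : ∀ w, 0 ≤ f w := fun w => by positivity
  have h1 : ∑ i ∈ A, ∫ w in Metric.ball (x i) (1 / 2), f w ≤ ∫ w, f w := by
    rw [← integral_biUnion_finset A (fun i _ => measurableSet_ball) h.pairwiseDisjoint_ball
      (fun i _ => hfi.integrableOn)]
    exact setIntegral_le_integral hfi (Eventually.of_forall hf0)
  have h2 : ∀ i ∈ A, π / 16 * f (x i) ≤ ∫ w in Metric.ball (x i) (1 / 2), f w := by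
    intro i _
    have h3 : ∫ w in Metric.ball (x i) (1 / 2), f (x i) / 4 ≤
        ∫ w in Metric.ball (x i) (1 / 2), f w := by
      refine setIntegral_mono_on (integrableOn_const (by
        rw [Complex.volume_ball]; exact ENNReal.mul_ne_top (by simp) (by simp)))
        hfi.integrableOn measurableSet_ball fun w hw => ?_
      rw [Metric.mem_ball, dist_eq_norm] at hw
      have h4 := norm_add_le (z - x i) (x i - w)
      rw [sub_add_sub_cancel, norm_sub_rev (x i) w] at h4
      simp only [hf]
      set p := ‖z - x i‖
      have hp : 0 ≤ p := norm_nonneg _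
      have hq : 0 ≤ ‖z - w‖ := norm_nonneg _
      rw [div_eq_mul_inv, ← mul_inv]
      apply inv_anti₀ (by positivity)
      calc (1 + ‖z - w‖) ^ 3 ≤ ((3 / 2) * (1 + p)) ^ 3 := by
            apply pow_le_pow_left₀ (by positivity); linarith
        _ ≤ (1 + p) ^ 3 * 4 := by
            rw [mul_pow]; nlinarith [pow_pos (show 0 < 1 + p by positivity) 3]
    rw [setIntegral_const, volume_real_ball _ (by norm_num), smul_eq_mul] at h3
    linarith
  have h5 : π / 16 * ∑ i ∈ A, f (x i) ≤ ∫ w, f w := by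
    rw [Finset.mul_sum]
    exact (Finset.sum_le_sum h2).trans h1
  rw [hI] at h5
  have hpi := Real.pi_pos
  calc ∑ i ∈ A, f (x i) = 16 / π * (π / 16 * ∑ i ∈ A, f (x i)) := by field_simp
    _ ≤ _ := by gcongr

/-- Cubic decay is summable over separated planar families, uniformly in the family. -/
theorem exists_sum_inv_cube_le : ∃ C : ℝ, 0 < C ∧ ∀ (A : Finset ℕ) (x : ℕ → ℂ) (s : ℝ), 0 < s →
    SepFamily A x s → ∀ z : ℂ, ∑ i ∈ A, ((1 + ‖z - x i‖ / s) ^ 3)⁻¹ ≤ C := by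
  refine ⟨16 / π * (∫ w : ℂ, ((1 + ‖w‖) ^ 3)⁻¹) + 1, ?_, fun A x s hs h z => ?_⟩
  · have : 0 ≤ ∫ w : ℂ, ((1 + ‖w‖) ^ 3)⁻¹ := integral_nonneg fun w => by positivity
    positivity
  · have hn : ∀ u v : ℂ, ‖u / (s : ℂ) - v / s‖ = ‖u - v‖ / s := fun u v => by
      rw [← sub_div, norm_div, Complex.norm_real, Real.norm_of_nonneg hs.le]
    have h' : SepFamily A (fun i => x i / s) 1 := by
      intro i hi j hj hij
      rw [hn, le_div_iff₀ hs, one_mul]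
      exact h i hi j hj hij
    have := h'.sum_inv_cube_le_of_one (z / s)
    simp only [hn] at this
    linarith

end Fock

/-! ### Superpositions of geometric kernels centred in a thin annulus -/

namespace Fock

/-- The cube of a geometric sum of length `m`. It equals `m ^ 3` at `1` and decays
like the inverse cube of the distance to `1` near the unit circle. -/
noncomputable def geomCube (m : ℕ) (u : ℂ) : ℂ := (∑ n ∈ Finset.range m, u ^ n) ^ 3

/-- A monomial modulated by a superposition of kernels `geomCube` centred at the points `x k`. -/
noncomputable def peakSum (m n : ℕ) (A : Finset ℕ) (x c : ℕ → ℂ) (z : ℂ) : ℂ :=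
  z ^ n * ∑ k ∈ A, c k * geomCube m (z / x k)

theorem norm_geom_sum_le (m : ℕ) (u : ℂ) :
    ‖∑ n ∈ Finset.range m, u ^ n‖ ≤ m * max 1 ‖u‖ ^ m := by
  refine (norm_sum_le _ _).trans ?_
  calc ∑ n ∈ Finset.range m, ‖u ^ n‖ ≤ ∑ n ∈ Finset.range m, max 1 ‖u‖ ^ m := by
        refine Finset.sum_le_sum fun n hn => ?_
        rw [norm_pow]
        exact (pow_le_pow_left₀ (norm_nonneg u) (le_max_right _ _) n).trans
          (pow_le_pow_right₀ (le_max_left _ _) (Finset.mem_range.1 hn).le)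
    _ = _ := by simp

theorem norm_geom_sum_mul_le (m : ℕ) (u : ℂ) :
    ‖∑ n ∈ Finset.range m, u ^ n‖ * ‖1 - u‖ ≤ 2 * max 1 ‖u‖ ^ m := by
  rw [← norm_mul, geom_sum_mul_neg]
  refine (norm_sub_le _ _).trans ?_
  rw [norm_one, norm_pow]
  have h1 : ‖u‖ ^ m ≤ max 1 ‖u‖ ^ m := pow_le_pow_left₀ (norm_nonneg u) (le_max_right _ _) m
  have h2 : 1 ≤ max 1 ‖u‖ ^ m := one_le_pow₀ (le_max_left _ _)
  linarith

/-- The family `x k`, `k ∈ A`, lies in a thin annulus with inner radius `R` (of relative width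
`O(1 / m)`), and it is separated at scale `δ R / m`. -/
structure ThinFamily (m : ℕ) (A : Finset ℕ) (x : ℕ → ℂ) (R Λ δ : ℝ) : Prop where
  m_pos : 0 < m
  R_pos : 0 < R
  one_le : 1 ≤ Λ
  δ_pos : 0 < δ
  le_norm : ∀ k ∈ A, R ≤ ‖x k‖
  pow_le : ∀ k ∈ A, (‖x k‖ / R) ^ m ≤ Λ
  sep : SepFamily A x (δ * R / m)

section Thin

variable {m : ℕ} {A : Finset ℕ} {x : ℕ → ℂ} {R Λ δ : ℝ}

theorem ThinFamily.norm_pos (h : ThinFamily m A x R Λ δ) {k : ℕ} (hk : k ∈ A) : 0 < ‖x k‖ :=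
  h.R_pos.trans_le (h.le_norm k hk)

theorem ThinFamily.norm_le (h : ThinFamily m A x R Λ δ) {k : ℕ} (hk : k ∈ A) :
    ‖x k‖ ≤ Λ * R := by
  have h1 : 1 ≤ ‖x k‖ / R := (one_le_div h.R_pos).2 (h.le_norm k hk)
  have h2 := (le_self_pow₀ h1 h.m_pos.ne').trans (h.pow_le k hk)
  rwa [div_le_iff₀ h.R_pos] at h2

theorem ThinFamily.scale_pos (h : ThinFamily m A x R Λ δ) : 0 < δ * R / m := by
  have := h.m_pos
  have := h.R_pos
  have := h.δ_pos
  positivity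

theorem norm_one_sub_div {z w : ℂ} (hw : w ≠ 0) : ‖1 - z / w‖ * ‖w‖ = ‖z - w‖ := by
  rw [← norm_mul, sub_mul, one_mul, div_mul_cancel₀ _ hw, norm_sub_rev]

theorem ThinFamily.norm_geomCube_le (h : ThinFamily m A x R Λ δ) {k : ℕ} (hk : k ∈ A) (z : ℂ) :
    ‖geomCube m (z / x k)‖ ≤ (m * (1 + 2 * Λ / δ) * max 1 (‖z‖ / R) ^ m) ^ 3 *
      ((1 + ‖z - x k‖ / (δ * R / m)) ^ 3)⁻¹ := by
  have hx := h.norm_pos hk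
  have hm : (0 : ℝ) < m := by exact_mod_cast h.m_pos
  have hR := h.R_pos
  have hδ := h.δ_pos
  set M := max 1 (‖z‖ / R) ^ m with hM
  have hM1 : max 1 ‖z / x k‖ ^ m ≤ M := by
    apply pow_le_pow_left₀ (by positivity)
    apply max_le_max le_rfl
    rw [norm_div]
    exact div_le_div_of_nonneg_left (norm_nonneg z) hR (h.le_norm k hk)
  have hM0 : 0 ≤ M := by positivity
  set g := ‖∑ n ∈ Finset.range m, (z / x k) ^ n‖ with hg
  have h1 : g ≤ m * M := (norm_geom_sum_le m _).trans (by gcongr)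
  have h2 : g * ‖z - x k‖ ≤ 2 * M * (Λ * R) := by
    rw [← norm_one_sub_div (norm_pos_iff.1 hx), ← mul_assoc]
    have := (norm_geom_sum_mul_le m (z / x k)).trans
      (mul_le_mul_of_nonneg_left hM1 zero_le_two)
    exact mul_le_mul this (h.norm_le hk) hx.le (by positivity)
  have h3 : g * (1 + ‖z - x k‖ / (δ * R / m)) ≤ m * (1 + 2 * Λ / δ) * M := by
    have e1 : g * (1 + ‖z - x k‖ / (δ * R / m)) = g + g * ‖z - x k‖ * (m / (δ * R)) := by
      field_simp
    have e2 : m * (1 + 2 * Λ / δ) * M = m * M + 2 * M * (Λ * R) * (m / (δ * R)) := by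
      field_simp
    rw [e1, e2]
    have : (0 : ℝ) ≤ m / (δ * R) := by positivity
    nlinarith [mul_le_mul_of_nonneg_right h2 this]
  have hpos : 0 < 1 + ‖z - x k‖ / (δ * R / m) := by
    have := h.scale_pos
    positivity
  rw [geomCube, norm_pow, ← hg, ← inv_pow, ← mul_pow]
  apply pow_le_pow_left₀ (norm_nonneg _)
  rwa [← div_eq_mul_inv, le_div_iff₀ hpos]

theorem ThinFamily.norm_geomCube_le_of_ne (h : ThinFamily m A x R Λ δ) {j k : ℕ} (hj : j ∈ A)
    (hk : k ∈ A) (hjk : j ≠ k) :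
    ‖geomCube m (x j / x k)‖ ≤ (m * (4 * Λ ^ 2 / δ)) ^ 3 *
      ((1 + ‖x j - x k‖ / (δ * R / m)) ^ 3)⁻¹ := by
  have hx := h.norm_pos hk
  have hm : (0 : ℝ) < m := by exact_mod_cast h.m_pos
  have hR := h.R_pos
  have hδ := h.δ_pos
  have hΛ := h.one_le
  have hM1 : max 1 ‖x j / x k‖ ^ m ≤ Λ := by
    rcases max_cases 1 ‖x j / x k‖ with ⟨h1, _⟩ | ⟨h1, _⟩
    · rw [h1]; simpa using h.one_le
    · rw [h1]
      refine le_trans ?_ (h.pow_le j hj)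
      apply pow_le_pow_left₀ (norm_nonneg _)
      rw [norm_div]
      exact div_le_div_of_nonneg_left (norm_nonneg _) hR (h.le_norm k hk)
  set g := ‖∑ n ∈ Finset.range m, (x j / x k) ^ n‖ with hg
  have h2 : g * ‖x j - x k‖ ≤ 2 * Λ * (Λ * R) := by
    rw [← norm_one_sub_div (norm_pos_iff.1 hx), ← mul_assoc]
    have := (norm_geom_sum_mul_le m (x j / x k)).trans
      (mul_le_mul_of_nonneg_left hM1 zero_le_two)
    exact mul_le_mul this (h.norm_le hk) hx.le (by positivity)
  have hs := h.scale_pos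
  have hy : 1 ≤ ‖x j - x k‖ / (δ * R / m) := (one_le_div hs).2 (h.sep j hj k hk hjk)
  have h3 : g * (1 + ‖x j - x k‖ / (δ * R / m)) ≤ m * (4 * Λ ^ 2 / δ) := by
    have hg0 : 0 ≤ g := norm_nonneg _
    calc g * (1 + ‖x j - x k‖ / (δ * R / m)) ≤ g * (2 * (‖x j - x k‖ / (δ * R / m))) := by
          apply mul_le_mul_of_nonneg_left _ hg0; linarith
      _ = g * ‖x j - x k‖ * (2 * m / (δ * R)) := by field_simp
      _ ≤ 2 * Λ * (Λ * R) * (2 * m / (δ * R)) := by gcongr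
      _ = _ := by field_simp; ring
  have hpos : 0 < 1 + ‖x j - x k‖ / (δ * R / m) := by positivity
  rw [geomCube, norm_pow, ← hg, ← inv_pow, ← mul_pow]
  apply pow_le_pow_left₀ (norm_nonneg _)
  rwa [← div_eq_mul_inv, le_div_iff₀ hpos]

theorem ThinFamily.norm_peakSum_le (h : ThinFamily m A x R Λ δ) {C : ℝ}
    (hC : ∀ z : ℂ, ∑ k ∈ A, ((1 + ‖z - x k‖ / (δ * R / m)) ^ 3)⁻¹ ≤ C)
    {c : ℕ → ℂ} (hc : ∀ k ∈ A, ‖c k‖ ≤ 1) (n : ℕ) (z : ℂ) :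
    ‖peakSum m n A x c z‖ ≤
      C * (1 + 2 * Λ / δ) ^ 3 * m ^ 3 * (‖z‖ ^ n * max 1 (‖z‖ / R) ^ (3 * m)) := by
  rw [peakSum, norm_mul, norm_pow]
  have h1 : ‖∑ k ∈ A, c k * geomCube m (z / x k)‖ ≤
      (m * (1 + 2 * Λ / δ) * max 1 (‖z‖ / R) ^ m) ^ 3 * C := by
    have hΛ := h.one_le
    have hδ := h.δ_pos
    calc ‖∑ k ∈ A, c k * geomCube m (z / x k)‖
        ≤ ∑ k ∈ A, (m * (1 + 2 * Λ / δ) * max 1 (‖z‖ / R) ^ m) ^ 3 *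
            ((1 + ‖z - x k‖ / (δ * R / m)) ^ 3)⁻¹ := by
          refine (norm_sum_le _ _).trans (Finset.sum_le_sum fun k hk => ?_)
          rw [norm_mul]
          exact (mul_le_of_le_one_left (norm_nonneg _) (hc k hk)).trans (h.norm_geomCube_le hk z)
      _ ≤ _ := by
          rw [← Finset.mul_sum]
          exact mul_le_mul_of_nonneg_left (hC z) (by positivity)
  calc ‖z‖ ^ n * ‖∑ k ∈ A, c k * geomCube m (z / x k)‖
      ≤ ‖z‖ ^ n * ((m * (1 + 2 * Λ / δ) * max 1 (‖z‖ / R) ^ m) ^ 3 * C) := by gcongr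
    _ = _ := by rw [mul_pow, mul_pow, ← pow_mul, mul_comm m 3]; ring

/-- Diagonal dominance: at a point `x j` of the family the `j`-th kernel contributes
`c_j m^3 x_j^n`, and the others only a fraction `O(δ^{-3})` of that. -/
theorem ThinFamily.norm_peakSum_sub_le (h : ThinFamily m A x R Λ δ) {C : ℝ}
    (hC : ∀ z : ℂ, ∑ k ∈ A, ((1 + ‖z - x k‖ / (δ * R / m)) ^ 3)⁻¹ ≤ C)
    {c : ℕ → ℂ} (hc : ∀ k ∈ A, ‖c k‖ ≤ 1) (n : ℕ) {j : ℕ} (hj : j ∈ A) :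
    ‖peakSum m n A x c (x j) - c j * m ^ 3 * x j ^ n‖ ≤
      ‖x j‖ ^ n * (m ^ 3 * ((4 * Λ ^ 2 / δ) ^ 3 * C)) := by
  have hd : c j * geomCube m (x j / x j) = c j * m ^ 3 := by
    rw [div_self (norm_pos_iff.1 (h.norm_pos hj)), geomCube]
    simp
  have e : peakSum m n A x c (x j) - c j * m ^ 3 * x j ^ n =
      x j ^ n * ∑ k ∈ A.erase j, c k * geomCube m (x j / x k) := by
    rw [peakSum, ← Finset.add_sum_erase A _ hj, hd]
    ring
  rw [e, norm_mul, norm_pow]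
  apply mul_le_mul_of_nonneg_left _ (by positivity)
  have hδ := h.δ_pos
  calc ‖∑ k ∈ A.erase j, c k * geomCube m (x j / x k)‖
      ≤ ∑ k ∈ A.erase j, (m * (4 * Λ ^ 2 / δ)) ^ 3 *
          ((1 + ‖x j - x k‖ / (δ * R / m)) ^ 3)⁻¹ := by
        refine (norm_sum_le _ _).trans (Finset.sum_le_sum fun k hk => ?_)
        rw [norm_mul]
        have hk' := Finset.mem_erase.1 hk
        have := h.norm_geomCube_le_of_ne hj hk'.2 hk'.1.symm
        exact (mul_le_of_le_one_left (norm_nonneg _) (hc k hk'.2)).trans this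
    _ ≤ (m * (4 * Λ ^ 2 / δ)) ^ 3 * C := by
        rw [← Finset.mul_sum]
        apply mul_le_mul_of_nonneg_left _ (by positivity)
        refine (Finset.sum_le_sum_of_subset_of_nonneg (Finset.erase_subset j A) ?_).trans (hC (x j))
        intro k _ _
        have := h.scale_pos
        positivity
    _ = _ := by ring

end Thin

end Fock

/-! ### Peaks of `r ^ n e^{-r^a}` and weighted `L²` bounds -/

namespace Fock

/-- Quantitative form of the fact that `r ^ n e^{-r^a}` peaks where `a r^a = n`: the value at any
`R` is within a bounded factor of the maximum as long as `|n - a R^a|` is `O(R^{a/2})`. -/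
theorem pow_mul_exp_neg_rpow_le {a r R : ℝ} (ha : 0 < a) (hr : 0 ≤ r) (hR : 0 < R) (n : ℕ) :
    r ^ n * Real.exp (-r ^ a) ≤
      R ^ n * Real.exp (-R ^ a) * Real.exp ((n - a * R ^ a) ^ 2 / (a ^ 2 * R ^ a)) := by
  have hRa : 0 < R ^ a := Real.rpow_pos_of_pos hR a
  have hra : 0 ≤ r ^ a := Real.rpow_nonneg hr a
  rcases Nat.eq_zero_or_pos n with rfl | hn
  · have : (((0 : ℕ) : ℝ) - a * R ^ a) ^ 2 / (a ^ 2 * R ^ a) = R ^ a := by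
      rw [Nat.cast_zero, zero_sub, neg_sq]
      field_simp
    rw [this, pow_zero, pow_zero, one_mul, one_mul, ← Real.exp_add]
    apply Real.exp_le_exp.2
    linarith
  rcases hr.eq_or_lt with rfl | hr
  · rw [zero_pow hn.ne', zero_mul]
    positivity
  have hra : 0 < r ^ a := Real.rpow_pos_of_pos hr a
  have hn' : (0 : ℝ) < n := by exact_mod_cast hn
  have key : n * Real.log r - r ^ a ≤
      n * Real.log R - R ^ a + (n - a * R ^ a) ^ 2 / (a ^ 2 * R ^ a) := by
    -- `log t ≤ t - 1`, at `t = a r ^ a / n` and at `t = n / (a R ^ a)`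
    have h1 := Real.log_le_sub_one_of_pos (show 0 < a * r ^ a / n by positivity)
    have h2 := Real.log_le_sub_one_of_pos (show 0 < n / (a * R ^ a) by positivity)
    rw [Real.log_div (by positivity) (by positivity), Real.log_mul (by positivity) (by positivity),
      Real.log_rpow hr] at h1
    rw [Real.log_div (by positivity) (by positivity), Real.log_mul (by positivity) (by positivity),
      Real.log_rpow hR] at h2
    have h3 : n / a * (a * Real.log r - a * Real.log R) ≤
        n / a * (a * r ^ a / n - 1 + (n / (a * R ^ a) - 1)) := by
      apply mul_le_mul_of_nonneg_left _ (by positivity)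
      linarith
    have e1 : n / a * (a * Real.log r - a * Real.log R) = n * Real.log r - n * Real.log R := by
      field_simp
    have e2 : n / a * (a * r ^ a / n - 1 + (n / (a * R ^ a) - 1)) =
        r ^ a - R ^ a + (n - a * R ^ a) ^ 2 / (a ^ 2 * R ^ a) := by
      field_simp
      ring
    linarith
  have e : ∀ t : ℝ, 0 < t → t ^ n * Real.exp (-t ^ a) = Real.exp (n * Real.log t - t ^ a) := by
    intro t ht
    rw [sub_eq_add_neg, Real.exp_add, mul_comm (n : ℝ), Real.exp_mul, Real.exp_log ht,
      Real.rpow_natCast]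
  rw [e r hr, e R hR, ← Real.exp_add]
  exact Real.exp_le_exp.2 key

/-- The profile `min (r / R, R / r) ^ m`. -/
noncomputable def profile (R : ℝ) (m : ℕ) (r : ℝ) : ℝ :=
  if r ≤ R then (r / R) ^ m else (R / r) ^ m

theorem profile_nonneg {R r : ℝ} (hR : 0 < R) (hr : 0 ≤ r) (m : ℕ) : 0 ≤ profile R m r := by
  unfold profile
  split_ifs <;> positivity

theorem profile_le_one {R r : ℝ} (hR : 0 < R) (hr : 0 ≤ r) (m : ℕ) : profile R m r ≤ 1 := by
  unfold profile
  split_ifs with h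
  · exact pow_le_one₀ (by positivity) ((div_le_one hR).2 h)
  · push Not at h
    exact pow_le_one₀ (by positivity) ((div_le_one (hR.trans h)).2 h.le)

/-- A monomial of degree close to `a R^a`, even multiplied by the growth of a polynomial of degree
`3 m` outside the disc of radius `R`, decays like `profile R m` relative to `e^{r^a}`. Outside the
disc this compares the degrees `n` and `n + 4 m`, inside it the degrees `n` and `n - m`. -/
theorem pow_mul_max_mul_exp_le {a R r K : ℝ} {m n : ℕ} (ha : 0 < a) (hR : 0 < R) (hr : 0 ≤ r)
    (hT : 1 ≤ R ^ a) (hn : a * R ^ a ≤ n) (hn' : n ≤ a * R ^ a + 1) (hmn : m ≤ n)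
    (hm : (m : ℝ) ^ 2 ≤ K ^ 2 * R ^ a) (hK : 0 ≤ K) :
    r ^ n * max 1 (r / R) ^ (3 * m) * Real.exp (-r ^ a) ≤
      Real.exp ((4 * K + 1) ^ 2 / a ^ 2) * (R ^ n * Real.exp (-R ^ a)) * profile R m r := by
  set T := R ^ a with hTdef
  have hT0 : 0 < T := by linarith
  have hm0 : (0 : ℝ) ≤ m := Nat.cast_nonneg m
  have hmain : ∀ N : ℕ, |(N : ℝ) - a * T| ≤ 4 * m + 1 →
      r ^ N * Real.exp (-r ^ a) ≤
        R ^ N * Real.exp (-T) * Real.exp ((4 * K + 1) ^ 2 / a ^ 2) := by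
    intro N hN
    refine (pow_mul_exp_neg_rpow_le ha hr hR N).trans ?_
    apply mul_le_mul_of_nonneg_left _ (by positivity)
    apply Real.exp_le_exp.2
    rw [← hTdef, div_le_div_iff₀ (by positivity) (by positivity)]
    have h1 : ((N : ℝ) - a * T) ^ 2 ≤ (4 * m + 1) ^ 2 := by
      rw [← sq_abs]; exact pow_le_pow_left₀ (abs_nonneg _) hN 2
    have h2 : (4 * (m : ℝ) + 1) ^ 2 ≤ (4 * K + 1) ^ 2 * T := by
      have h3 : (m : ℝ) ≤ K * T := by
        apply le_of_sq_le_sq _ (by positivity)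
        rw [mul_pow]
        have : K ^ 2 * T ≤ K ^ 2 * T ^ 2 := by
          apply mul_le_mul_of_nonneg_left _ (by positivity)
          nlinarith
        linarith
      nlinarith
    have h4 := mul_le_mul_of_nonneg_right (h1.trans h2) (sq_nonneg a)
    linarith
  unfold profile
  split_ifs with h
  · rw [max_eq_left ((div_le_one hR).2 h), one_pow, mul_one]
    have h1 := hmain (n - m) (by
      rw [Nat.cast_sub hmn, abs_le]; constructor <;> linarith)
    have h2 := mul_le_mul_of_nonneg_left h1 (pow_nonneg hr m)
    have e1 : r ^ m * (r ^ (n - m) * Real.exp (-r ^ a)) = r ^ n * Real.exp (-r ^ a) := by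
      rw [← mul_assoc, ← pow_add, Nat.add_sub_cancel' hmn]
    have e2 : R ^ n = R ^ m * R ^ (n - m) := by rw [← pow_add, Nat.add_sub_cancel' hmn]
    rw [e1] at h2
    refine h2.trans (le_of_eq ?_)
    rw [e2, div_pow]
    field_simp
  · push Not at h
    have hr0 : 0 < r := hR.trans h
    rw [max_eq_right ((one_le_div hR).2 h.le)]
    have h1 := hmain (n + 4 * m) (by
      push_cast; rw [abs_le]; constructor <;> linarith)
    have h2 := mul_le_mul_of_nonneg_left h1 (show 0 ≤ (R ^ (3 * m) * r ^ m)⁻¹ by positivity)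
    have e1 : r ^ n * (r / R) ^ (3 * m) * Real.exp (-r ^ a) =
        (R ^ (3 * m) * r ^ m)⁻¹ * (r ^ (n + 4 * m) * Real.exp (-r ^ a)) := by
      rw [div_pow, show n + 4 * m = n + 3 * m + m by ring, pow_add, pow_add]
      field_simp
    rw [e1]
    refine h2.trans (le_of_eq ?_)
    rw [div_pow, show n + 4 * m = n + 3 * m + m by ring, pow_add, pow_add]
    field_simp

theorem profile_sq_integral {R : ℝ} {m : ℕ} (hR : 0 < R) (hm : 2 ≤ m) :
    IntegrableOn (fun y : ℝ => y * profile R m y ^ 2) (Ioi 0) ∧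
      ∫ y in Ioi (0 : ℝ), y * profile R m y ^ 2 ≤ 2 * R ^ 2 / m := by
  have hm' : (2 : ℝ) ≤ m := by exact_mod_cast hm
  have e1 : EqOn (fun y : ℝ => y * profile R m y ^ 2)
      (fun y => (R ^ (2 * m))⁻¹ * y ^ (2 * m + 1)) (Ioc 0 R) := by
    intro y hy
    simp only [profile, if_pos hy.2, div_pow]
    field_simp
    ring
  have e2 : EqOn (fun y : ℝ => y * profile R m y ^ 2)
      (fun y => R ^ (2 * m) * y ^ (1 - 2 * m : ℝ)) (Ioi R) := by
    intro y hy
    have hy0 : 0 < y := hR.trans hy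
    simp only [profile, if_neg (not_le.2 (show R < y from hy)), div_pow]
    rw [Real.rpow_sub hy0, Real.rpow_one, show (2 * (m : ℝ)) = ((2 * m : ℕ) : ℝ) by push_cast; ring,
      Real.rpow_natCast]
    field_simp
    ring
  have i1 : IntegrableOn (fun y : ℝ => y * profile R m y ^ 2) (Ioc 0 R) := by
    refine IntegrableOn.congr_fun ?_ e1.symm measurableSet_Ioc
    exact (Continuous.integrableOn_Icc (by fun_prop)).mono_set Ioc_subset_Icc_self
  have i2 : IntegrableOn (fun y : ℝ => y * profile R m y ^ 2) (Ioi R) := by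
    refine IntegrableOn.congr_fun ?_ e2.symm measurableSet_Ioi
    exact (integrableOn_Ioi_rpow_of_lt (by linarith) hR).const_mul _
  have hu : Ioi (0 : ℝ) = Ioc 0 R ∪ Ioi R := (Ioc_union_Ioi_eq_Ioi hR.le).symm
  refine ⟨hu ▸ i1.union i2, ?_⟩
  rw [hu, setIntegral_union (Ioc_disjoint_Ioi le_rfl) measurableSet_Ioi i1 i2,
    setIntegral_congr_fun measurableSet_Ioc e1, setIntegral_congr_fun measurableSet_Ioi e2,
    integral_const_mul, integral_const_mul, integral_Ioi_rpow_of_lt (by linarith) hR,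
    ← intervalIntegral.integral_of_le hR.le, integral_pow]
  have e3 : R ^ (2 * m) * (-R ^ ((1 - 2 * m : ℝ) + 1) / ((1 - 2 * m : ℝ) + 1)) =
      R ^ 2 / (2 * m - 2) := by
    have : R ^ ((1 - 2 * m : ℝ) + 1) = R ^ 2 / R ^ (2 * m) := by
      rw [show (1 - 2 * m : ℝ) + 1 = ((2 : ℕ) : ℝ) - ((2 * m : ℕ) : ℝ) by push_cast; ring,
        Real.rpow_sub hR, Real.rpow_natCast, Real.rpow_natCast]
    rw [this, show (1 - 2 * m : ℝ) + 1 = -(2 * m - 2) by ring]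
    have : (2 * m - 2 : ℝ) ≠ 0 := by linarith
    field_simp
  have e4 : (R ^ (2 * m))⁻¹ * ((R ^ (2 * m + 1 + 1) - 0 ^ (2 * m + 1 + 1)) /
      (((2 * m + 1 : ℕ) : ℝ) + 1)) = R ^ 2 / (2 * m + 2) := by
    rw [zero_pow (by omega), sub_zero, show 2 * m + 1 + 1 = 2 * m + 2 by ring, pow_add]
    push_cast
    rw [show (2 * (m : ℝ) + 1 + 1) = 2 * m + 2 by ring]
    field_simp
  rw [e3, e4]
  have h1 : R ^ 2 / (2 * m + 2) ≤ R ^ 2 / m := by gcongr; linarith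
  have h2 : R ^ 2 / (2 * m - 2) ≤ R ^ 2 / m := by gcongr; linarith
  have h3 : 2 * R ^ 2 / m = R ^ 2 / m + R ^ 2 / m := by ring
  linarith

theorem lintegral_profile_sq_le {R : ℝ} {m : ℕ} (hR : 0 < R) (hm : 2 ≤ m) :
    ∫⁻ z : ℂ, ENNReal.ofReal (profile R m ‖z‖ ^ 2) ≤ ENNReal.ofReal (4 * π * R ^ 2 / m) := by
  obtain ⟨h1, h2⟩ := profile_sq_integral hR hm
  have hi : Integrable (fun z : ℂ => (fun y => profile R m y ^ 2) ‖z‖) := by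
    refine (integrable_fun_norm_addHaar (volume : Measure ℂ) (f := fun y => profile R m y ^ 2)).2 ?_
    simpa [Complex.finrank_real_complex] using h1
  have h3 := integral_fun_norm_addHaar (volume : Measure ℂ) (fun y => profile R m y ^ 2)
  rw [← ofReal_integral_eq_lintegral_ofReal hi (Eventually.of_forall fun z => by positivity)]
  apply ENNReal.ofReal_le_ofReal
  rw [h3, Complex.finrank_real_complex, volume_real_ball _ zero_le_one]
  simp only [Nat.add_one_sub_one, pow_one, smul_eq_mul, nsmul_eq_mul, one_pow, one_mul]
  push_cast
  have := mul_le_mul_of_nonneg_left h2 Real.pi_pos.le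
  calc 2 * (π * ∫ y in Ioi (0 : ℝ), y * profile R m y ^ 2) ≤ 2 * (π * (2 * R ^ 2 / m)) := by
        linarith
    _ = _ := by ring

theorem enorm_sq_mul_ofReal_exp (w : ℂ) (t : ℝ) :
    ‖w‖ₑ ^ 2 * ENNReal.ofReal (Real.exp (-2 * t)) =
      ENNReal.ofReal ((‖w‖ * Real.exp (-t)) ^ 2) := by
  rw [← ofReal_norm, ← ENNReal.ofReal_pow (norm_nonneg _),
    ← ENNReal.ofReal_mul (by positivity), mul_pow, ← Real.exp_nat_mul]
  congr 3
  push_cast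
  ring

/-- `L²` bound in the weighted space for a function with a profile majorant. -/
theorem lintegral_sq_le_of_profile {φ : ℝ → ℝ} {R B : ℝ} {m : ℕ} (hR : 0 < R) (hm : 2 ≤ m)
    {g : ℂ → ℂ} (hg : ∀ z, ‖g z‖ * Real.exp (-φ ‖z‖) ≤ B * profile R m ‖z‖) :
    ∫⁻ z : ℂ, ‖g z‖ₑ ^ 2 * ENNReal.ofReal (Real.exp (-2 * φ ‖z‖)) ≤
      ENNReal.ofReal (B ^ 2 * (4 * π * R ^ 2 / m)) := by
  calc ∫⁻ z : ℂ, ‖g z‖ₑ ^ 2 * ENNReal.ofReal (Real.exp (-2 * φ ‖z‖))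
      ≤ ∫⁻ z : ℂ, ENNReal.ofReal (B ^ 2) * ENNReal.ofReal (profile R m ‖z‖ ^ 2) := by
        apply lintegral_mono
        intro z
        simp only
        rw [enorm_sq_mul_ofReal_exp, ← ENNReal.ofReal_mul (sq_nonneg B), ← mul_pow]
        exact ENNReal.ofReal_le_ofReal (pow_le_pow_left₀ (by positivity) (hg z) 2)
    _ = ENNReal.ofReal (B ^ 2) * ∫⁻ z : ℂ, ENNReal.ofReal (profile R m ‖z‖ ^ 2) :=
        lintegral_const_mul' _ _ ENNReal.ofReal_ne_top
    _ ≤ _ := by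
        rw [ENNReal.ofReal_mul (sq_nonneg B)]
        gcongr
        exact lintegral_profile_sq_le hR hm

end Fock

/-! ### Banach–Steinhaus for sums of point evaluations -/

namespace Fock

theorem summable_norm_of_lp_one (c : lp (fun _ : ℕ => ℂ) 1) : Summable fun j => ‖c j‖ := by
  have := (memℓp_gen_iff (p := 1) (by simp)).1 (lp.memℓp c)
  simpa using this

theorem norm_lp_one (c : lp (fun _ : ℕ => ℂ) 1) : ‖c‖ = ∑' j, ‖c j‖ := by
  rw [lp.norm_eq_tsum_rpow (by simp) c]
  simp

theorem summable_mul_of_bounded {c b : ℕ → ℂ} (hc : Summable fun j => ‖c j‖) {B : ℝ}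
    (hb : ∀ j, ‖b j‖ ≤ B) : Summable fun j => ‖c j * b j‖ :=
  Summable.of_nonneg_of_le (fun _ => norm_nonneg _)
    (fun j => by rw [norm_mul]; exact mul_le_mul_of_nonneg_left (hb j) (norm_nonneg _))
    (hc.mul_right B)

/-- Pairing of absolutely summable sequences with a bounded sequence. -/
noncomputable def pairing (b : ℕ → ℂ) (B : ℝ) (hb : ∀ j, ‖b j‖ ≤ B) :
    lp (fun _ : ℕ => ℂ) 1 →L[ℂ] ℂ :=
  LinearMap.mkContinuous
    { toFun := fun c => ∑' j, c j * b j
      map_add' := fun c d => by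
        have hc := (summable_mul_of_bounded (summable_norm_of_lp_one c) hb).of_norm
        have hd := (summable_mul_of_bounded (summable_norm_of_lp_one d) hb).of_norm
        rw [← hc.tsum_add hd]
        congr 1
        ext j
        simp [add_mul]
      map_smul' := fun t c => by
        simp only [lp.coeFn_smul, Pi.smul_apply, smul_eq_mul, RingHom.id_apply, mul_assoc]
        rw [tsum_mul_left] }
    B fun c => by
      have h := summable_mul_of_bounded (summable_norm_of_lp_one c) hb
      refine (norm_tsum_le_tsum_norm h).trans ?_
      rw [norm_lp_one, ← tsum_mul_left]
      refine h.tsum_le_tsum (fun j => ?_) ((summable_norm_of_lp_one c).mul_left B)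
      rw [norm_mul, mul_comm]
      exact mul_le_mul_of_nonneg_right (hb j) (norm_nonneg _)

theorem pairing_apply (b : ℕ → ℂ) (B : ℝ) (hb : ∀ j, ‖b j‖ ≤ B) (c : lp (fun _ : ℕ => ℂ) 1) :
    pairing b B hb c = ∑' j, c j * b j := rfl

theorem norm_tsum_mul_sq_le {c b : ℕ → ℂ} (hc : Summable fun j => ‖c j‖) {B : ℝ}
    (hb : ∀ j, ‖b j‖ ≤ B) :
    Summable (fun j => ‖c j‖ * ‖b j‖ ^ 2) ∧
      ‖∑' j, c j * b j‖ ^ 2 ≤ (∑' j, ‖c j‖) * ∑' j, ‖c j‖ * ‖b j‖ ^ 2 := by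
  have h1 : Summable fun j => ‖c j‖ * ‖b j‖ ^ 2 :=
    Summable.of_nonneg_of_le (fun _ => by positivity)
      (fun j => mul_le_mul_of_nonneg_left (pow_le_pow_left₀ (norm_nonneg _) (hb j) 2)
        (norm_nonneg _)) (hc.mul_right (B ^ 2))
  have h2 := summable_mul_of_bounded hc hb
  refine ⟨h1, ?_⟩
  have h3 : (∑' j, ‖c j * b j‖) ^ 2 ≤ (∑' j, ‖c j‖) * ∑' j, ‖c j‖ * ‖b j‖ ^ 2 := by
    refine le_of_tendsto (h2.hasSum.pow 2) (Eventually.of_forall fun s => ?_)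
    calc (∑ j ∈ s, ‖c j * b j‖) ^ 2 ≤ (∑ j ∈ s, ‖c j‖) * ∑ j ∈ s, ‖c j‖ * ‖b j‖ ^ 2 := by
          refine Finset.sum_sq_le_sum_mul_sum_of_sq_le_mul s (fun _ _ => norm_nonneg _)
            (fun _ _ => by positivity) fun j _ => ?_
          rw [norm_mul, mul_pow, sq ‖c j‖, mul_assoc]
      _ ≤ _ := by
          apply mul_le_mul (hc.sum_le_tsum s fun _ _ => norm_nonneg _)
            (h1.sum_le_tsum s fun _ _ => by positivity) (Finset.sum_nonneg fun _ _ => by positivity)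
            (tsum_nonneg fun _ => norm_nonneg _)
  exact (pow_le_pow_left₀ (norm_nonneg _) (norm_tsum_le_tsum_norm h2) 2).trans h3

theorem differentiable_tsum_mul {F : ℕ → ℂ → ℂ} (hF : ∀ i, Differentiable ℂ (F i))
    (hb : ∀ r : ℝ, ∃ B : ℝ, ∀ i z, ‖z‖ ≤ r → ‖F i z‖ ≤ B) {c : ℕ → ℂ}
    (hc : Summable fun j => ‖c j‖) : Differentiable ℂ fun z => ∑' j, c j * F j z := by
  intro z
  obtain ⟨B, hB⟩ := hb (‖z‖ + 1)
  have h := Complex.differentiableOn_tsum_of_summable_norm (U := Metric.ball 0 (‖z‖ + 1))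
    (F := fun j z => c j * F j z) (hc.mul_right B)
    (fun j => ((hF j).const_mul (c j)).differentiableOn) Metric.isOpen_ball (fun j w hw => by
      rw [norm_mul]
      apply mul_le_mul_of_nonneg_left _ (norm_nonneg _)
      apply hB
      simpa using (mem_ball_zero_iff.1 hw).le)
  exact h.differentiableAt (Metric.isOpen_ball.mem_nhds (by simp))

theorem tsum_mul_mem_space {φ : ℝ → ℝ} (hφ : Continuous (radial φ)) {F : ℕ → ℂ → ℂ}
    (hF : ∀ i, Differentiable ℂ (F i))
    (hb : ∀ r : ℝ, ∃ B : ℝ, ∀ i z, ‖z‖ ≤ r → ‖F i z‖ ≤ B) {C : ℝ≥0∞} (hC : C ≠ ∞)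
    (hn : ∀ i, ∫⁻ z : ℂ, ‖F i z‖ₑ ^ 2 * ENNReal.ofReal (Real.exp (-2 * φ ‖z‖)) ≤ C)
    {c : ℕ → ℂ} (hc : Summable fun j => ‖c j‖) : (fun z => ∑' j, c j * F j z) ∈ space φ := by
  refine ⟨differentiable_tsum_mul hF hb hc, ?_⟩
  apply ENNReal.rpow_lt_top_of_nonneg (by norm_num)
  apply ne_of_lt
  set W : ℂ → ℝ≥0∞ := fun z => ENNReal.ofReal (Real.exp (-2 * φ ‖z‖)) with hW
  have hWm : Measurable W :=
    (Real.continuous_exp.comp (hφ.const_mul (-2))).measurable.ennreal_ofReal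
  have hpt : ∀ z, ‖∑' j, c j * F j z‖ₑ ^ 2 * W z ≤
      ∑' j, ENNReal.ofReal (∑' j, ‖c j‖) * ENNReal.ofReal ‖c j‖ * (‖F j z‖ₑ ^ 2 * W z) := by
    intro z
    obtain ⟨B, hB⟩ := hb ‖z‖
    obtain ⟨h1, h2⟩ := norm_tsum_mul_sq_le hc (b := fun j => F j z) (fun j => hB j z le_rfl)
    have h3 : ‖∑' j, c j * F j z‖ₑ ^ 2 ≤
        ENNReal.ofReal (∑' j, ‖c j‖) * ∑' j, ENNReal.ofReal ‖c j‖ * ‖F j z‖ₑ ^ 2 := by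
      rw [← ofReal_norm, ← ENNReal.ofReal_pow (norm_nonneg _)]
      refine (ENNReal.ofReal_le_ofReal h2).trans (le_of_eq ?_)
      rw [ENNReal.ofReal_mul (tsum_nonneg fun _ => norm_nonneg _),
        ENNReal.ofReal_tsum_of_nonneg (fun _ => by positivity) h1]
      congr 2
      ext j
      rw [ENNReal.ofReal_mul (norm_nonneg _), ENNReal.ofReal_pow (norm_nonneg _), ofReal_norm (F j z)]
    calc _ ≤ _ * W z := mul_le_mul_left h3 _
      _ = _ := by
        rw [← ENNReal.tsum_mul_left, ← ENNReal.tsum_mul_right]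
        congr 1
        ext j
        ring
  calc ∫⁻ z : ℂ, ‖∑' j, c j * F j z‖ₑ ^ 2 * W z
      ≤ ∫⁻ z : ℂ, ∑' j, ENNReal.ofReal (∑' j, ‖c j‖) * ENNReal.ofReal ‖c j‖ *
          (‖F j z‖ₑ ^ 2 * W z) := lintegral_mono hpt
    _ = ∑' j, ENNReal.ofReal (∑' j, ‖c j‖) * ENNReal.ofReal ‖c j‖ *
          ∫⁻ z : ℂ, ‖F j z‖ₑ ^ 2 * W z := by
        have hm : ∀ j, Measurable fun z => ‖F j z‖ₑ ^ 2 * W z := fun j =>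
          ((hF j).continuous.measurable.enorm.pow_const 2).mul hWm
        rw [lintegral_tsum fun j => ((hm j).const_mul _).aemeasurable]
        congr 1
        ext j
        exact lintegral_const_mul _ (hm j)
    _ ≤ ∑' j, ENNReal.ofReal (∑' j, ‖c j‖) * ENNReal.ofReal ‖c j‖ * C :=
        ENNReal.tsum_le_tsum fun j => mul_le_mul_right (hn j) _
    _ = ENNReal.ofReal (∑' j, ‖c j‖) * ENNReal.ofReal (∑' j, ‖c j‖) * C := by
        rw [ENNReal.tsum_mul_right, ENNReal.tsum_mul_left,
          ENNReal.ofReal_tsum_of_nonneg (fun _ => norm_nonneg _) hc]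
    _ < ∞ := by
        apply ENNReal.mul_lt_top (ENNReal.mul_lt_top ENNReal.ofReal_lt_top ENNReal.ofReal_lt_top)
        exact hC.lt_top

/-- A resonance principle. If functionals built from finitely many point evaluations are unbounded
along a bounded, locally bounded sequence of the weighted Fock space, then they are unbounded at a
single element of the space. It is the Banach–Steinhaus theorem for the map
`c ↦ ∑ c_j F_j` on absolutely summable sequences. -/
theorem exists_mem_space_unbounded {φ : ℝ → ℝ} (hφ : Continuous (radial φ)) {F : ℕ → ℂ → ℂ}
    (hF : ∀ i, Differentiable ℂ (F i))
    (hb : ∀ r : ℝ, ∃ B : ℝ, ∀ i z, ‖z‖ ≤ r → ‖F i z‖ ≤ B) {C : ℝ≥0∞} (hC : C ≠ ∞)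
    (hn : ∀ i, ∫⁻ z : ℂ, ‖F i z‖ₑ ^ 2 * ENNReal.ofReal (Real.exp (-2 * φ ‖z‖)) ≤ C)
    (A : ℕ → Finset ℕ) (x : ℕ → ℂ) (w : ℕ → ℕ → ℂ)
    (hu : ∀ B : ℝ, ∃ i, B < ‖∑ k ∈ A i, w i k * F i (x k)‖) :
    ∃ f ∈ space φ, ∀ B : ℝ, ∃ i, B < ‖∑ k ∈ A i, w i k * f (x k)‖ := by
  by_contra hcon
  push Not at hcon
  choose B hB using fun k => hb ‖x k‖
  set ev : ℕ → lp (fun _ : ℕ => ℂ) 1 →L[ℂ] ℂ := fun k =>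
    pairing (fun j => F j (x k)) (B k) (fun j => hB k j (x k) le_rfl) with hev
  obtain ⟨K, hK⟩ := banach_steinhaus (g := fun i => ∑ k ∈ A i, w i k • ev k) (by
    intro c
    obtain ⟨D, hD⟩ := hcon _ (tsum_mul_mem_space hφ hF hb hC hn (summable_norm_of_lp_one c))
    refine ⟨D, fun i => ?_⟩
    have e : (∑ k ∈ A i, w i k • ev k) c = ∑ k ∈ A i, w i k * ∑' j, c j * F j (x k) := by
      simp [hev, pairing_apply]
    rw [e]
    exact hD i)
  obtain ⟨i, hi⟩ := hu K
  have h1 : (∑ k ∈ A i, w i k • ev k) (lp.single 1 i (1 : ℂ)) =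
      ∑ k ∈ A i, w i k * F i (x k) := by
    simp only [hev, _root_.sum_apply, _root_.smul_apply, pairing_apply,
      smul_eq_mul]
    refine Finset.sum_congr rfl fun k _ => ?_
    rw [tsum_eq_single i]
    · simp
    · intro j hj
      simp [lp.single_apply, hj]
  have h2 := (∑ k ∈ A i, w i k • ev k).le_opNorm (lp.single 1 i (1 : ℂ))
  rw [h1, lp.norm_single (by simp)] at h2
  have h3 := hK i
  simp only [norm_one, mul_one] at h2
  linarith

end Fock

/-! ### Zeros of an entire function and Jensen's formula -/

namespace Fock

section Zeros

variable {S : ℂ → ℂ} {l : ℕ → ℂ}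

theorem eventually_ne_zero_of_ordering (hS : Differentiable ℂ S) (hl : IsOrdering (zeroSet S) l)
    (z : ℂ) : ∀ᶠ w in 𝓝[≠] z, S w ≠ 0 := by
  have hA : AnalyticOnNhd ℂ S univ := fun w _ => hS.analyticAt w
  by_contra h
  have h0 := hA.eqOn_zero_of_preconnected_of_frequently_eq_zero isPreconnected_univ (mem_univ z)
    (fun h' => h h')
  have h1 : zeroSet S = univ := by
    ext w
    simpa [zeroSet] using h0 (mem_univ w)
  have h2 : (univ : Set ℂ).Countable := by
    rw [← h1, ← hl.range_eq]
    exact countable_range l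
  exact not_countable_complex h2

theorem finite_norm_le (hS : Differentiable ℂ S) (hl : IsOrdering (zeroSet S) l) (X : ℝ) :
    {k : ℕ | ‖l k‖ ≤ X}.Finite := by
  by_contra h
  have h1 : (l '' {k : ℕ | ‖l k‖ ≤ X}).Infinite := Set.Infinite.image hl.injective.injOn h
  obtain ⟨z, -, hz⟩ := h1.exists_accPt_of_subset_isCompact (isCompact_closedBall (0 : ℂ) X) (by
    rintro _ ⟨k, hk, rfl⟩
    simpa using hk)
  rw [accPt_iff_frequently_nhdsNE] at hz
  refine hz ((eventually_ne_zero_of_ordering hS hl z).mono fun w hw hmem => hw ?_)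
  obtain ⟨k, -, rfl⟩ := hmem
  have : l k ∈ zeroSet S := hl.range_eq ▸ mem_range_self k
  exact this

theorem exists_of_mem_zeroSet (hl : IsOrdering (zeroSet S) l) {z : ℂ} (hz : S z = 0) :
    ∃ k, l k = z := by
  have : z ∈ range l := hl.range_eq ▸ hz
  exact this

theorem map_ordering_eq_zero (hl : IsOrdering (zeroSet S) l) (k : ℕ) : S (l k) = 0 := by
  have : l k ∈ zeroSet S := hl.range_eq ▸ mem_range_self k
  exact this

theorem le_infDist_zeroSet (hl : IsOrdering (zeroSet S) l) {z : ℂ} {d : ℝ}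
    (h : ∀ k, d ≤ ‖z - l k‖) : d ≤ Metric.infDist z (zeroSet S) := by
  rw [Metric.le_infDist ⟨l 0, map_ordering_eq_zero hl 0⟩]
  intro w hw
  obtain ⟨k, rfl⟩ := exists_of_mem_zeroSet hl hw
  rw [dist_eq_norm]
  exact h k

/-- The number of zeros of modulus at most `X`. -/
noncomputable def zeroCount (l : ℕ → ℂ) (X : ℝ) : ℕ := {k : ℕ | ‖l k‖ ≤ X}.ncard

theorem exists_neg_log_norm_le (hS : Differentiable ℂ S) (hl : IsOrdering (zeroSet S) l) :
    ∃ C : ℝ, 0 ≤ C ∧ ∀ k, -Real.log ‖l k‖ ≤ C := by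
  obtain ⟨C, hC⟩ := ((finite_norm_le hS hl 1).image fun k => -Real.log ‖l k‖).bddAbove
  refine ⟨max C 0, le_max_right _ _, fun k => ?_⟩
  rcases le_or_gt ‖l k‖ 1 with h | h
  · exact (hC ⟨k, h, rfl⟩).trans (le_max_left _ _)
  · have := Real.log_pos h
    linarith [le_max_right C 0]

/-- All zeros being simple, the divisor of `S` takes the values `0` and `1`, and it vanishes away
from the zeros. -/
theorem divisor_le_one (hS : Differentiable ℂ S)
    (hs : ∀ z, S z = 0 → deriv S z ≠ 0) (U : Set ℂ) (z : ℂ) :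
    0 ≤ MeromorphicOn.divisor S U z ∧ MeromorphicOn.divisor S U z ≤ 1 ∧
      (S z ≠ 0 ∨ z ∉ U → MeromorphicOn.divisor S U z = 0) := by
  by_cases hz : z ∈ U
  · have hA : AnalyticOnNhd ℂ S U := fun w _ => hS.analyticAt w
    rw [MeromorphicOn.AnalyticOnNhd.divisor_apply hA hz]
    by_cases h0 : S z = 0
    · rw [(hS.analyticAt z).analyticOrderAt_eq_one_of_zero_deriv_ne_zero h0 (hs z h0)]
      refine ⟨by simp, by simp, fun h => ?_⟩
      rcases h with h | h <;> contradiction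
    · rw [(hS.analyticAt z).analyticOrderAt_eq_zero.2 h0]
      simp
  · rw [(MeromorphicOn.divisor S U).apply_eq_zero_of_notMem hz]
    simp

/-- Jensen's formula, read as a lower bound for the number of zeros. -/
theorem exists_le_zeroCount_mul_log (hS : Differentiable ℂ S) (hl : IsOrdering (zeroSet S) l)
    (hs : ∀ z, S z = 0 → deriv S z ≠ 0) :
    ∃ C : ℝ, ∀ r b : ℝ, 1 ≤ r → (∀ z : ℂ, ‖z‖ = r → b ≤ Real.log ‖S z‖) →
      b ≤ (zeroCount l r + 1) * (Real.log r + C) := by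
  obtain ⟨C₁, hC₁, hC₁'⟩ := exists_neg_log_norm_le hS hl
  set t := Real.log ‖meromorphicTrailingCoeffAt S 0‖ with ht
  refine ⟨max C₁ t, fun r b hr hb => ?_⟩
  have hr0 : 0 < r := by linarith
  have hlog : 0 ≤ Real.log r := Real.log_nonneg hr
  have hA : AnalyticOnNhd ℂ S (Metric.closedBall 0 |r|) := fun w _ => hS.analyticAt w
  have hA' : AnalyticOnNhd ℂ S (Metric.sphere 0 |r|) := fun w _ => hS.analyticAt w
  have hJ := MeromorphicOn.circleAverage_log_norm hr0.ne' hA.meromorphicOn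
  have hlow : b ≤ Real.circleAverage (fun z => Real.log ‖S z‖) 0 r := by
    rw [← Real.circleAverage_const b 0 r]
    refine Real.circleAverage_mono (circleIntegrable_const _ _ _)
      hA'.meromorphicOn.circleIntegrable_log_norm fun z hz => hb z ?_
    simpa [abs_of_pos hr0] using hz
  rw [hJ] at hlow
  set D := MeromorphicOn.divisor S (Metric.closedBall 0 |r|) with hD
  have hfin := finite_norm_le hS hl r
  set K := hfin.toFinset with hK
  have hKcard : zeroCount l r = K.card := Set.ncard_eq_toFinset_card _ hfin
  have hsum : ∑ᶠ u, (D u : ℝ) * Real.log (r * ‖0 - u‖⁻¹) =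
      ∑ k ∈ K, (D (l k) : ℝ) * Real.log (r * ‖0 - l k‖⁻¹) := by
    rw [finsum_eq_sum_of_support_subset (s := K.image l), Finset.sum_image hl.injective.injOn]
    intro u hu
    have hu' : D u ≠ 0 := by
      intro h0
      apply hu
      simp [h0]
    have h3 := (divisor_le_one hS hs (Metric.closedBall 0 |r|) u).2.2
    have h4 : S u = 0 ∧ u ∈ Metric.closedBall (0 : ℂ) |r| := by
      by_contra hcon
      rw [not_and_or] at hcon
      exact hu' (h3 hcon)
    obtain ⟨k, rfl⟩ := exists_of_mem_zeroSet hl h4.1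
    simp only [Finset.coe_image]
    refine ⟨k, ?_, rfl⟩
    simpa [hK, abs_of_pos hr0] using h4.2
  have hterm : ∀ k ∈ K, (D (l k) : ℝ) * Real.log (r * ‖0 - l k‖⁻¹) ≤ Real.log r + C₁ := by
    intro k _
    obtain ⟨h1, h2, -⟩ := divisor_le_one hS hs (Metric.closedBall 0 |r|) (l k)
    have h1' : (0 : ℝ) ≤ D (l k) := by exact_mod_cast h1
    have h2' : (D (l k) : ℝ) ≤ 1 := by exact_mod_cast h2
    have h3 : Real.log (r * ‖0 - l k‖⁻¹) ≤ Real.log r + C₁ := by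
      rw [zero_sub, norm_neg]
      rcases eq_or_ne (l k) 0 with h0 | h0
      · rw [h0, norm_zero, inv_zero, mul_zero, Real.log_zero]
        linarith
      · rw [Real.log_mul hr0.ne' (inv_ne_zero (norm_ne_zero_iff.2 h0)), Real.log_inv]
        linarith [hC₁' k]
    nlinarith
  have h0 := divisor_le_one hS hs (Metric.closedBall 0 |r|) 0
  have h01 : (D 0 : ℝ) ≤ 1 := by exact_mod_cast h0.2.1
  rw [hsum] at hlow
  have hS1 := Finset.sum_le_sum hterm
  rw [Finset.sum_const, nsmul_eq_mul, ← hKcard] at hS1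
  have hm1 := le_max_left C₁ t
  have hm2 := le_max_right C₁ t
  have h5 : (D 0 : ℝ) * Real.log r ≤ Real.log r := mul_le_of_le_one_left hlog h01
  have h6 : (zeroCount l r : ℝ) * (Real.log r + C₁) ≤ zeroCount l r * (Real.log r + max C₁ t) := by
    gcongr
  rw [add_mul, one_mul]
  linarith

/-- Intervals of length `2 η` around the moduli `|l k|`, `k ∈ K`, do not cover `[X, 2X]` if their
total length is less than `X`. -/
theorem exists_radius_avoiding (K : Finset ℕ) (l : ℕ → ℂ) {X η : ℝ} (hη : 0 ≤ η)
    (h : 2 * η * K.card < X) : ∃ r ∈ Icc X (2 * X), ∀ k ∈ K, η ≤ |r - ‖l k‖| := by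
  by_contra hcon
  push Not at hcon
  have hsub : Icc X (2 * X) ⊆ ⋃ k ∈ K, Metric.ball ‖l k‖ η := by
    intro r hr
    obtain ⟨k, hk, hlt⟩ := hcon r hr
    simp only [mem_iUnion]
    exact ⟨k, hk, by rwa [Metric.mem_ball, Real.dist_eq]⟩
  have h1 := (measure_mono (μ := volume) hsub).trans (measure_biUnion_finset_le K _)
  simp only [Real.volume_ball, Real.volume_Icc, Finset.sum_const, nsmul_eq_mul] at h1
  rw [← ENNReal.ofReal_natCast, ← ENNReal.ofReal_mul (Nat.cast_nonneg _),
    ENNReal.ofReal_le_ofReal_iff (by positivity)] at h1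
  linarith

end Zeros

end Fock

/-! ### Functions of class `𝒮_γ` and their zeros in thin annuli -/

namespace Fock

/-- The factor `e^φ ρ^{-1} (1 + |z|)^{-γ}`, which compares `|S(z)|` with the distance from `z` to
the zero set for `S` of class `𝒮_γ`. -/
noncomputable def sineMajorant (φ : ℝ → ℝ) (γ : ℝ) (z : ℂ) : ℝ :=
  Real.exp (φ ‖z‖) / rho φ z * (1 / (1 + ‖z‖) ^ γ)

section Sine

variable {a γ : ℝ} {φ : ℝ → ℝ} {S : ℂ → ℂ} {l : ℕ → ℂ}

theorem sineMajorant_pos (hφ : IsWeight φ) (z : ℂ) : 0 < sineMajorant φ γ z := by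
  have h1 := rho_pos hφ z
  have h2 : 0 < (1 + ‖z‖) ^ γ := Real.rpow_pos_of_pos (by positivity) _
  unfold sineMajorant
  positivity

theorem continuous_sineMajorant (hφ : IsWeight φ) : Continuous (sineMajorant φ γ) := by
  have h1 : Continuous fun z : ℂ => φ ‖z‖ := hφ.contDiff.continuous
  have h2 : ∀ z : ℂ, (1 + ‖z‖) ≠ 0 := fun z => by positivity
  unfold sineMajorant
  refine ((Real.continuous_exp.comp h1).div (continuous_rho hφ) fun z => (rho_pos hφ z).ne').mul ?_
  refine continuous_const.div ((continuous_const.add continuous_norm).rpow_const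
    fun z => Or.inl (h2 z)) fun z => ?_
  exact (Real.rpow_pos_of_pos (by positivity) _).ne'

theorem SineClass.exists_bounds (hS : SineClass φ γ S) : ∃ C : ℝ, 0 < C ∧ ∀ z : ℂ,
    ‖S z‖ ≤ C * (sineMajorant φ γ z * Metric.infDist z (zeroSet S)) ∧
    sineMajorant φ γ z * Metric.infDist z (zeroSet S) ≤ C * ‖S z‖ := by
  obtain ⟨C, hC, h⟩ := hS.comparable
  refine ⟨C, hC, fun z => ?_⟩
  have e : Real.exp (φ ‖z‖) * (Metric.infDist z (zeroSet S) / rho φ z) * (1 / (1 + ‖z‖) ^ γ) =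
      sineMajorant φ γ z * Metric.infDist z (zeroSet S) := by
    unfold sineMajorant
    ring
  have := h z (mem_univ z)
  simp only [e] at this
  exact this

/-- Near a zero `z` the distance to the zero set is the distance to `z`, so the zeros of `S` are
simple and `|S'|` is comparable with the majorant there. -/
theorem SineClass.exists_deriv_bounds (hφ : IsWeight φ) (hS : SineClass φ γ S)
    (hl : IsOrdering (zeroSet S) l) : ∃ C : ℝ, 0 < C ∧ ∀ z : ℂ, S z = 0 →
      ‖deriv S z‖ ≤ C * sineMajorant φ γ z ∧ sineMajorant φ γ z ≤ C * ‖deriv S z‖ := by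
  obtain ⟨C, hC, h⟩ := hS.exists_bounds
  refine ⟨C, hC, fun z hz => ?_⟩
  have hd : Tendsto (fun w => ‖slope S z w‖) (𝓝[≠] z) (𝓝 ‖deriv S z‖) :=
    (hasDerivAt_iff_tendsto_slope.1 (hS.entire z).hasDerivAt).norm
  have hm : Tendsto (sineMajorant φ γ) (𝓝[≠] z) (𝓝 (sineMajorant φ γ z)) :=
    ((continuous_sineMajorant hφ).tendsto z).mono_left nhdsWithin_le_nhds
  have hsl : ∀ w, ‖slope S z w‖ = ‖S w‖ / ‖w - z‖ := by
    intro w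
    rw [slope_def_field, hz, sub_zero, norm_div]
  -- close to the zero `z`, the nearest zero is `z` itself
  obtain ⟨ε, hε, hball⟩ := Metric.mem_nhdsWithin_iff.1 (eventually_ne_zero_of_ordering hS.entire hl z)
  have hdist : ∀ᶠ w in 𝓝[≠] z, Metric.infDist w (zeroSet S) = ‖w - z‖ := by
    filter_upwards [nhdsWithin_le_nhds (Metric.ball_mem_nhds z (half_pos hε))] with w hw
    rw [Metric.mem_ball, dist_eq_norm] at hw
    refine le_antisymm (by rw [← dist_eq_norm]; exact Metric.infDist_le_dist_of_mem hz)
      (le_infDist_zeroSet hl fun k => ?_)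
    by_cases hk : l k = z
    · rw [hk]
    · have h1 : ε ≤ ‖l k - z‖ := by
        by_contra hlt
        push Not at hlt
        exact hball ⟨by rwa [Metric.mem_ball, dist_eq_norm], hk⟩ (map_ordering_eq_zero hl k)
      have h2 := norm_add_le (l k - w) (w - z)
      rw [sub_add_sub_cancel, norm_sub_rev (l k) w] at h2
      linarith
  have hne : ∀ᶠ w in 𝓝[≠] z, 0 < ‖w - z‖ := by
    filter_upwards [self_mem_nhdsWithin] with w hw
    exact norm_pos_iff.2 (sub_ne_zero.2 hw)
  constructor
  · refine le_of_tendsto_of_tendsto hd (hm.const_mul C) ?_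
    filter_upwards [hdist, hne] with w h1 h2
    rw [hsl, div_le_iff₀ h2, mul_assoc, ← h1]
    exact (h w).1
  · refine le_of_tendsto_of_tendsto hm (hd.const_mul C) ?_
    filter_upwards [hdist, hne] with w h1 h2
    rw [hsl, ← mul_div_assoc, le_div_iff₀ h2, ← h1]
    exact (h w).2

theorem SineClass.deriv_ne_zero (hφ : IsWeight φ) (hS : SineClass φ γ S)
    (hl : IsOrdering (zeroSet S) l) (z : ℂ) (hz : S z = 0) : deriv S z ≠ 0 := by
  obtain ⟨C, -, h⟩ := hS.exists_deriv_bounds hφ hl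
  intro h0
  have := (h z hz).2
  rw [h0, norm_zero, mul_zero] at this
  exact absurd (sineMajorant_pos hφ z) (not_lt.2 this)

theorem SineClass.exists_log_norm_ge (ha : 0 < a) (hφ : IsWeight φ)
    (hpow : ∀ r : ℝ, 1 < r → φ r = r ^ a) (hS : SineClass φ γ S) :
    ∃ C₁ C₂ : ℝ, ∀ z : ℂ, 2 ≤ ‖z‖ → (‖z‖ ^ 3)⁻¹ ≤ Metric.infDist z (zeroSet S) →
      ‖z‖ ^ a - C₁ * Real.log ‖z‖ - C₂ ≤ Real.log ‖S z‖ := by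
  obtain ⟨C, hC, h⟩ := hS.exists_bounds
  refine ⟨(1 - a / 2) + 2 * |γ| + 3, Real.log C - Real.log a, fun z hz hd => ?_⟩
  set r := ‖z‖ with hr
  have hr0 : 0 < r := by linarith
  have hr1 : 1 < r := by linarith
  have hdpos : 0 < Metric.infDist z (zeroSet S) := lt_of_lt_of_le (by positivity) hd
  have hmpos := sineMajorant_pos (γ := γ) hφ z
  have h1 := (h z).2
  have hSpos : 0 < ‖S z‖ := by
    have : 0 < C * ‖S z‖ := lt_of_lt_of_le (mul_pos hmpos hdpos) h1
    exact pos_of_mul_pos_right this hC.le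
  have h2 := Real.log_le_log (mul_pos hmpos hdpos) h1
  rw [Real.log_mul hmpos.ne' hdpos.ne', Real.log_mul hC.ne' hSpos.ne'] at h2
  have h3 : -(3 * Real.log r) ≤ Real.log (Metric.infDist z (zeroSet S)) := by
    have := Real.log_le_log (by positivity) hd
    rw [Real.log_inv, Real.log_pow] at this
    exact_mod_cast this
  have hrpos := rho_pos hφ z
  have hgpos : 0 < (1 + r) ^ γ := Real.rpow_pos_of_pos (by positivity) _
  have h4 : Real.log (sineMajorant φ γ z) =
      r ^ a - ((1 - a / 2) * Real.log r - Real.log a) - γ * Real.log (1 + r) := by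
    rw [sineMajorant, Real.log_mul (by positivity) (by positivity),
      Real.log_div (by positivity) (by positivity), Real.log_exp, one_div, Real.log_inv,
      Real.log_rpow (by positivity), hpow _ hr1, rho_of_one_lt ha hpow hr1,
      Real.log_div (by positivity) ha.ne', Real.log_rpow hr0]
    ring
  have h5 : γ * Real.log (1 + r) ≤ |γ| * (2 * Real.log r) := by
    have e1 : 0 ≤ Real.log (1 + r) := Real.log_nonneg (by linarith)
    have e2 : Real.log (1 + r) ≤ 2 * Real.log r := by
      have := Real.log_le_log (by positivity) (show 1 + r ≤ r ^ 2 by nlinarith)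
      rw [Real.log_pow] at this
      exact_mod_cast this
    exact (mul_le_mul_of_nonneg_right (le_abs_self γ) e1).trans
      (mul_le_mul_of_nonneg_left e2 (abs_nonneg _))
  rw [h4] at h2
  linarith

theorem isLittleO_rpow_rpow_atTop_of_lt {p q : ℝ} (h : p < q) :
    (fun r : ℝ => r ^ p) =o[atTop] fun r : ℝ => r ^ q := by
  refine (Asymptotics.isLittleO_iff_tendsto' ?_).2 ?_
  · filter_upwards [eventually_gt_atTop 0] with r hr h0
    exact absurd h0 (Real.rpow_pos_of_pos hr q).ne'
  · refine (tendsto_rpow_neg_atTop (sub_pos.2 h)).congr' ?_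
    filter_upwards [eventually_gt_atTop 0] with r hr
    rw [← Real.rpow_sub hr, neg_sub]

/-- The inequality that contradicts Jensen's formula when `S` has only `O(r^κ)` zeros. -/
theorem eventually_jensen_lt {κ : ℝ} (hκ : 0 ≤ κ) (hκa : κ < a) (C C₀ C₁ C₂ : ℝ) :
    ∀ᶠ r : ℝ in atTop,
      (C * r ^ κ + 1) * (Real.log r + C₀) < r ^ a - C₁ * Real.log r - C₂ := by
  have ha : 0 < a := hκ.trans_lt hκa
  have hlog : (fun r : ℝ => Real.log r) =o[atTop] fun r : ℝ => r ^ a :=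
    isLittleO_log_rpow_atTop ha
  have hc : ∀ c : ℝ, (fun _ : ℝ => c) =o[atTop] fun r : ℝ => r ^ a := fun c =>
    Asymptotics.isLittleO_const_left.2 (Or.inr
      (tendsto_norm_atTop_atTop.comp (tendsto_rpow_atTop ha)))
  have hk : (fun r : ℝ => r ^ κ) =o[atTop] fun r : ℝ => r ^ a := isLittleO_rpow_rpow_atTop_of_lt hκa
  have hkl : (fun r : ℝ => r ^ κ * Real.log r) =o[atTop] fun r : ℝ => r ^ a := by
    have h1 := (Asymptotics.isBigO_refl (fun r : ℝ => r ^ κ) atTop).mul_isLittleO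
      (isLittleO_log_rpow_atTop (sub_pos.2 hκa))
    refine h1.congr' EventuallyEq.rfl ?_
    filter_upwards [eventually_gt_atTop 0] with r hr
    rw [← Real.rpow_add hr]
    congr 1
    ring
  have hsum := ((((hkl.const_mul_left C).add (hk.const_mul_left (C * C₀))).add
    (hlog.const_mul_left (1 + C₁))).add (hc (C₀ + C₂))).def (c := 1 / 2) (by norm_num)
  filter_upwards [hsum, eventually_gt_atTop 0] with r h1 hr
  have hra : 0 < r ^ a := Real.rpow_pos_of_pos hr a
  rw [Real.norm_of_nonneg hra.le] at h1
  have h2 := (le_abs_self _).trans h1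
  nlinarith

/-- The zeros of a function of class `𝒮_γ` have convergence exponent at least `a`: their counting
function is not `O(X^κ)` for any `κ < a`. -/
theorem SineClass.frequently_lt_zeroCount (ha : 0 < a) (ha' : a ≤ 2) (hφ : IsWeight φ)
    (hpow : ∀ r : ℝ, 1 < r → φ r = r ^ a) (hS : SineClass φ γ S)
    (hl : IsOrdering (zeroSet S) l) {κ : ℝ} (hκ : 0 ≤ κ) (hκa : κ < a) (C : ℝ) :
    ∃ᶠ X : ℝ in atTop, C * X ^ κ < zeroCount l X := by
  intro hcon
  simp only [not_lt] at hcon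
  obtain ⟨C₀, hJ⟩ := exists_le_zeroCount_mul_log hS.entire hl (hS.deriv_ne_zero hφ hl)
  obtain ⟨C₁, C₂, hlow⟩ := hS.exists_log_norm_ge ha hφ hpow
  obtain ⟨X₁, hX₁⟩ := eventually_atTop.1 (hcon.and ((eventually_jensen_lt hκ hκa C C₀ C₁ C₂).and
    (eventually_ge_atTop (max 2 (Real.exp (-C₀))))))
  have hlim : ∀ᶠ X : ℝ in atTop, 2 * C * (3 ^ κ * X ^ κ) < X ^ 4 := by
    have h1 : (fun r : ℝ => r ^ κ) =o[atTop] fun r : ℝ => r ^ (4 : ℝ) :=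
      isLittleO_rpow_rpow_atTop_of_lt (by linarith)
    filter_upwards [(h1.const_mul_left (2 * C * 3 ^ κ)).def (c := 1 / 2) (by norm_num),
      eventually_gt_atTop 0] with X h2 hX
    have hX4 : X ^ (4 : ℝ) = X ^ 4 := by norm_cast
    rw [hX4, Real.norm_of_nonneg (by positivity : 0 ≤ X ^ 4)] at h2
    have h3 := (le_abs_self _).trans h2
    have : 0 < X ^ 4 := by positivity
    nlinarith
  obtain ⟨X, hXlim, hX⟩ := (hlim.and (eventually_ge_atTop (max X₁ 2))).exists
  have hXX₁ : X₁ ≤ X := (le_max_left _ _).trans hX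
  have hX2 : 2 ≤ X := (le_max_right _ _).trans hX
  have hX0 : 0 < X := by linarith
  have hfin := finite_norm_le hS.entire hl (3 * X)
  have hcard : (hfin.toFinset.card : ℝ) ≤ C * (3 ^ κ * X ^ κ) := by
    rw [← Set.ncard_eq_toFinset_card _ hfin, ← Real.mul_rpow (by norm_num) hX0.le]
    exact (hX₁ (3 * X) (by linarith)).1
  obtain ⟨r, ⟨hr1, hr2⟩, hr⟩ := exists_radius_avoiding hfin.toFinset l (X := X) (η := (X ^ 3)⁻¹)
    (by positivity) (by
      rw [show 2 * (X ^ 3)⁻¹ * (hfin.toFinset.card : ℝ) = 2 * hfin.toFinset.card / X ^ 3 by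
        field_simp, div_lt_iff₀ (by positivity)]
      nlinarith)
  obtain ⟨hr3, hr4, hr5⟩ := hX₁ r (hXX₁.trans hr1)
  have hr0 : 0 < r := by linarith
  have h1 : r ^ a - C₁ * Real.log r - C₂ ≤ (zeroCount l r + 1) * (Real.log r + C₀) := by
    refine hJ r _ (by linarith) fun z hz => ?_
    have := hlow z (by linarith) (le_infDist_zeroSet hl fun k => ?_)
    · rwa [hz] at this
    rw [hz]
    have hle : (r ^ 3)⁻¹ ≤ (X ^ 3)⁻¹ := inv_anti₀ (by positivity) (by gcongr)
    have hab := abs_norm_sub_norm_le z (l k)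
    rw [hz] at hab
    rcases le_or_gt ‖l k‖ (3 * X) with hk | hk
    · exact (hle.trans (hr k (by simpa using hk))).trans hab
    · have h2 : (X ^ 3)⁻¹ ≤ 1 := inv_le_one_of_one_le₀ (one_le_pow₀ (by linarith))
      have h3 := neg_abs_le (r - ‖l k‖)
      linarith
  have h6 : 0 ≤ Real.log r + C₀ := by
    have := Real.log_le_log (Real.exp_pos _) ((le_max_right _ _).trans hr5)
    rw [Real.log_exp] at this
    linarith
  have h7 : ((zeroCount l r : ℝ) + 1) * (Real.log r + C₀) ≤
      (C * r ^ κ + 1) * (Real.log r + C₀) := by gcongr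
  linarith

/-- Indices of the zeros in the `m`-th thin annulus `m ε ≤ |λ|^{a/2} < (m + 1) ε`, which has
width comparable with `ε ρ`. -/
def annulus (a ε : ℝ) (l : ℕ → ℂ) (m : ℕ) : Set ℕ :=
  {k | m * ε ≤ ‖l k‖ ^ (a / 2) ∧ ‖l k‖ ^ (a / 2) < (m + 1) * ε}

theorem annulus_finite (ha : 0 < a) (hS : Differentiable ℂ S) (hl : IsOrdering (zeroSet S) l)
    (ε : ℝ) (m : ℕ) : (annulus a ε l m).Finite := by
  refine (finite_norm_le hS hl (((m + 1) * ε) ^ (2 / a))).subset fun k hk => ?_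
  have h1 := Real.rpow_le_rpow (by positivity) hk.2.le (show 0 ≤ 2 / a by positivity)
  rwa [← Real.rpow_mul (norm_nonneg _), show a / 2 * (2 / a) = 1 by field_simp, Real.rpow_one] at h1

/-- Infinitely many thin annuli contain almost as many zeros as the separation permits. -/
theorem SineClass.frequently_le_ncard_annulus (ha : 0 < a) (ha' : a ≤ 2) (hφ : IsWeight φ)
    (hpow : ∀ r : ℝ, 1 < r → φ r = r ^ a) (hS : SineClass φ γ S)
    (hl : IsOrdering (zeroSet S) l) {ε τ : ℝ} (hε : 0 < ε) (hτ : 0 < τ) (hτ' : τ < 1) :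
    ∃ᶠ m : ℕ in atTop, (m : ℝ) ^ (1 - τ) ≤ (annulus a ε l m).ncard := by
  intro hcon
  simp only [not_le] at hcon
  obtain ⟨m₀, hm₀⟩ := eventually_atTop.1 hcon
  set B : ℝ := ∑ m ∈ Finset.range m₀, ((annulus a ε l m).ncard : ℝ) with hB
  have hB0 : 0 ≤ B := Finset.sum_nonneg fun _ _ => Nat.cast_nonneg _
  have hbound : ∀ X : ℝ, 1 ≤ X → (zeroCount l X : ℝ) ≤
      (B + 1) * (1 / ε + 1) ^ (2 - τ) * X ^ (a / 2 * (2 - τ)) := by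
    intro X hX
    have hX0 : 0 ≤ X := by linarith
    have hXa : 1 ≤ X ^ (a / 2) := Real.one_le_rpow hX (by positivity)
    set M := ⌊X ^ (a / 2) / ε⌋₊ with hM
    have hMle : (M : ℝ) + 1 ≤ (1 / ε + 1) * X ^ (a / 2) := by
      have := Nat.floor_le (show 0 ≤ X ^ (a / 2) / ε by positivity)
      rw [add_mul, one_mul, one_div_mul_eq_div]
      linarith
    have hsub : {k : ℕ | ‖l k‖ ≤ X} ⊆ ⋃ m ∈ Finset.range (M + 1), annulus a ε l m := by
      intro k hk
      have h0 : 0 ≤ ‖l k‖ ^ (a / 2) / ε := by positivity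
      simp only [mem_iUnion]
      refine ⟨⌊‖l k‖ ^ (a / 2) / ε⌋₊, ?_, ?_, ?_⟩
      · rw [Finset.mem_range, Nat.lt_succ_iff]
        apply Nat.floor_le_floor
        gcongr
        exact hk
      · rw [← le_div_iff₀ hε]
        exact Nat.floor_le h0
      · rw [← div_lt_iff₀ hε]
        exact Nat.lt_floor_add_one _
    have hfin : (⋃ m ∈ Finset.range (M + 1), annulus a ε l m).Finite :=
      Set.Finite.biUnion (Finset.finite_toSet _) fun m _ => annulus_finite ha hS.entire hl ε m
    have h1 : zeroCount l X ≤ ∑ m ∈ Finset.range (M + 1), (annulus a ε l m).ncard :=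
      (Set.ncard_le_ncard hsub hfin).trans (Finset.set_ncard_biUnion_le _ _)
    have h2 : ∑ m ∈ Finset.range (M + 1), ((annulus a ε l m).ncard : ℝ) ≤
        B + ∑ m ∈ Finset.range (M + 1), ((M : ℝ) + 1) ^ (1 - τ) := by
      have h3 : ∀ m ∈ Finset.range (M + 1), ((annulus a ε l m).ncard : ℝ) ≤
          (if m < m₀ then ((annulus a ε l m).ncard : ℝ) else 0) + ((M : ℝ) + 1) ^ (1 - τ) := by
        intro m hm
        have hp : 0 ≤ ((M : ℝ) + 1) ^ (1 - τ) := by positivity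
        split_ifs with h
        · linarith
        · have h4 := (hm₀ m (not_lt.1 h)).le
          have h5 : (m : ℝ) ^ (1 - τ) ≤ ((M : ℝ) + 1) ^ (1 - τ) := by
            apply Real.rpow_le_rpow (by positivity) _ (by linarith)
            exact_mod_cast (Finset.mem_range.1 hm).le
          linarith
      refine (Finset.sum_le_sum h3).trans ?_
      rw [Finset.sum_add_distrib]
      gcongr
      rw [← Finset.sum_filter]
      refine Finset.sum_le_sum_of_subset_of_nonneg (fun m hm => ?_) fun _ _ _ => Nat.cast_nonneg _
      exact Finset.mem_range.2 (Finset.mem_filter.1 hm).2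
    have hM1 : (1 : ℝ) ≤ (M : ℝ) + 1 := by
      have : (0 : ℝ) ≤ M := Nat.cast_nonneg M
      linarith
    have h6 : ∑ m ∈ Finset.range (M + 1), ((M : ℝ) + 1) ^ (1 - τ) = ((M : ℝ) + 1) ^ (2 - τ) := by
      rw [Finset.sum_const, Finset.card_range, nsmul_eq_mul]
      push_cast
      rw [show (2 - τ) = 1 + (1 - τ) by ring, Real.rpow_add (by positivity), Real.rpow_one]
    have h7 : (1 : ℝ) ≤ ((M : ℝ) + 1) ^ (2 - τ) := Real.one_le_rpow hM1 (by linarith)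
    calc (zeroCount l X : ℝ) ≤ B + ((M : ℝ) + 1) ^ (2 - τ) := by
          rw [← h6]; exact le_trans (by exact_mod_cast h1) h2
      _ ≤ (B + 1) * ((M : ℝ) + 1) ^ (2 - τ) := by nlinarith
      _ ≤ (B + 1) * ((1 / ε + 1) * X ^ (a / 2)) ^ (2 - τ) := by
          gcongr
          linarith
      _ = _ := by
          rw [Real.mul_rpow (by positivity) (by positivity), ← Real.rpow_mul hX0]
          ring
  have hfreq := hS.frequently_lt_zeroCount ha ha' hφ hpow hl (κ := a / 2 * (2 - τ))
    (by apply mul_nonneg <;> linarith) (by nlinarith) ((B + 1) * (1 / ε + 1) ^ (2 - τ))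
  obtain ⟨X, hX1, hX2⟩ := (hfreq.and_eventually (eventually_ge_atTop 1)).exists
  exact absurd (hbound X hX2) (not_le.2 hX1)

end Sine

end Fock

/-! ### Normalised peak sums at the zeros -/

namespace Fock

/-- Inner radius of the `m`-th thin annulus. -/
noncomputable def innerRadius (a ε : ℝ) (m : ℕ) : ℝ := (m * ε) ^ (2 / a)

section InnerRadius

variable {a ε : ℝ} {m : ℕ}

theorem innerRadius_pos (hε : 0 < ε) (hm : 0 < m) : 0 < innerRadius a ε m := by
  unfold innerRadius
  positivity

theorem innerRadius_rpow_half (ha : 0 < a) (hε : 0 < ε) :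
    innerRadius a ε m ^ (a / 2) = m * ε := by
  rw [innerRadius, ← Real.rpow_mul (by positivity), show 2 / a * (a / 2) = 1 by field_simp,
    Real.rpow_one]

theorem innerRadius_rpow (ha : 0 < a) (hε : 0 < ε) :
    innerRadius a ε m ^ a = (m * ε) ^ 2 := by
  rw [innerRadius, ← Real.rpow_mul (by positivity), show 2 / a * a = ((2 : ℕ) : ℝ) by
    push_cast; field_simp, Real.rpow_natCast]

theorem le_innerRadius (ha : 0 < a) (ha' : a ≤ 2) (h : 1 ≤ m * ε) :
    m * ε ≤ innerRadius a ε m := by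
  unfold innerRadius
  exact Real.self_le_rpow_of_one_le h ((one_le_div ha).2 ha')

theorem innerRadius_rpow_one_sub (ha : 0 < a) (hε : 0 < ε) (hm : 0 < m) :
    innerRadius a ε m ^ (1 - a / 2) = innerRadius a ε m / (m * ε) := by
  rw [Real.rpow_sub (innerRadius_pos hε hm), Real.rpow_one, innerRadius_rpow_half ha hε]

end InnerRadius

theorem rpow_bounds_of_mem_Icc {y Y : ℝ} (γ : ℝ) (h1 : 1 ≤ y) (h2 : y ≤ Y) :
    Y ^ (-|γ|) ≤ y ^ γ ∧ y ^ γ ≤ Y ^ |γ| := by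
  have hy : 0 < y := by linarith
  have hY : 0 < Y := by linarith
  constructor
  · calc Y ^ (-|γ|) ≤ y ^ (-|γ|) := by
          rw [Real.rpow_neg hY.le, Real.rpow_neg hy.le]
          exact inv_anti₀ (Real.rpow_pos_of_pos hy _) (Real.rpow_le_rpow hy.le h2 (abs_nonneg _))
      _ ≤ y ^ γ := Real.rpow_le_rpow_of_exponent_le h1 (neg_abs_le γ)
  · exact (Real.rpow_le_rpow_of_exponent_le h1 (le_abs_self γ)).trans
      (Real.rpow_le_rpow hy.le h2 (abs_nonneg _))

theorem differentiable_peakSum (m n : ℕ) (A : Finset ℕ) (x c : ℕ → ℂ) :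
    Differentiable ℂ (peakSum m n A x c) := by
  unfold peakSum geomCube
  fun_prop

theorem exists_phase (u : ℂ) : ∃ c : ℂ, ‖c‖ ≤ 1 ∧ c * u = ‖u‖ := by
  rcases eq_or_ne u 0 with rfl | hu
  · exact ⟨0, by simp, by simp⟩
  · refine ⟨‖u‖ / u, ?_, div_mul_cancel₀ _ hu⟩
    rw [norm_div, Complex.norm_real, norm_norm, div_self (norm_ne_zero_iff.2 hu)]

section Sine

variable {a γ : ℝ} {φ : ℝ → ℝ} {S : ℂ → ℂ} {l : ℕ → ℂ}

/-- The zeros of modulus at least `R > 1` are `δ₀ ρ(R)`-separated, as `ρ` increases. -/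
theorem exists_separation (ha : 0 < a) (ha' : a ≤ 2)
    (hpow : ∀ r : ℝ, 1 < r → φ r = r ^ a) (hφ : IsWeight φ) (hS : SineClass φ γ S)
    (hl : IsOrdering (zeroSet S) l) : ∃ δ₀ : ℝ, 0 < δ₀ ∧ ∀ R : ℝ, 1 < R → ∀ i j : ℕ, i ≠ j →
      R ≤ ‖l i‖ → R ≤ ‖l j‖ → δ₀ * (R ^ (1 - a / 2) / a) ≤ ‖l i - l j‖ := by
  obtain ⟨δ₀, hδ₀, h⟩ := hS.separated
  refine ⟨δ₀, hδ₀, fun R hR i j hij hi hj => ?_⟩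
  have h1 := h (l i) (map_ordering_eq_zero hl i) (l j) (map_ordering_eq_zero hl j)
    (hl.injective.ne hij)
  have hmin : 0 < min (rho φ (l i)) (rho φ (l j)) := lt_min (rho_pos hφ _) (rho_pos hφ _)
  rw [dRho, le_div_iff₀ hmin] at h1
  have hr : ∀ k, R ≤ ‖l k‖ → R ^ (1 - a / 2) / a ≤ rho φ (l k) := by
    intro k hk
    rw [rho_of_one_lt ha hpow (hR.trans_le hk)]
    gcongr
    linarith
  exact (mul_le_mul_of_nonneg_left (le_min (hr i hi) (hr j hj)) hδ₀.le).trans h1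

theorem thinFamily_annulus (ha : 0 < a) {δ₀ ε : ℝ} (hδ₀ : 0 < δ₀)
    (hsep : ∀ R : ℝ, 1 < R → ∀ i j : ℕ, i ≠ j →
      R ≤ ‖l i‖ → R ≤ ‖l j‖ → δ₀ * (R ^ (1 - a / 2) / a) ≤ ‖l i - l j‖)
    (hε : 0 < ε) {m : ℕ} (hm : 0 < m) (hR : 1 < innerRadius a ε m) {A : Finset ℕ}
    (hA : ∀ k ∈ A, k ∈ annulus a ε l m) :
    ThinFamily m A l (innerRadius a ε m) (Real.exp (2 / a)) (δ₀ / (a * ε)) := by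
  have hm' : (0 : ℝ) < m := by exact_mod_cast hm
  have hR0 := innerRadius_pos (a := a) hε hm
  have hle : ∀ k ∈ A, innerRadius a ε m ≤ ‖l k‖ := by
    intro k hk
    have h1 := (hA k hk).1
    rw [← innerRadius_rpow_half ha hε] at h1
    exact (Real.rpow_le_rpow_iff hR0.le (norm_nonneg _) (by positivity)).1 h1
  refine ⟨hm, hR0, Real.one_le_exp (by positivity), by positivity, hle, fun k hk => ?_,
    fun i hi j hj hij => ?_⟩
  · have h2 := (hA k hk).2
    have hy : 0 ≤ ‖l k‖ / innerRadius a ε m := by positivity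
    have h3 : (‖l k‖ / innerRadius a ε m) ^ (a / 2) ≤ Real.exp (1 / m) := by
      rw [Real.div_rpow (norm_nonneg _) hR0.le, innerRadius_rpow_half ha hε,
        div_le_iff₀ (by positivity)]
      have h4 := Real.add_one_le_exp (1 / (m : ℝ))
      have h5 : (m + 1) * ε = (1 / (m : ℝ) + 1) * (m * ε) := by field_simp; ring
      rw [h5] at h2
      exact h2.le.trans (mul_le_mul_of_nonneg_right h4 (by positivity))
    have h6 := Real.rpow_le_rpow (by positivity) h3 (show 0 ≤ 2 / a * m by positivity)
    rw [← Real.rpow_mul hy, ← Real.exp_mul] at h6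
    rw [show a / 2 * (2 / a * m) = (m : ℝ) by field_simp, Real.rpow_natCast] at h6
    refine h6.trans (le_of_eq ?_)
    congr 1
    field_simp
  · have h1 := hsep _ hR i j hij (hle i hi) (hle j hj)
    rw [innerRadius_rpow_one_sub ha hε hm] at h1
    refine le_trans (le_of_eq ?_) h1
    field_simp

theorem ThinFamily.norm_le_two_mul {m : ℕ} {A : Finset ℕ} {x : ℕ → ℂ} {R Λ δ : ℝ}
    (h : ThinFamily m A x R Λ δ) (hΛ : Λ ≤ m) {k : ℕ} (hk : k ∈ A) : ‖x k‖ ≤ 2 * R := by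
  have h1 : (‖x k‖ / R) ^ m ≤ 2 ^ m :=
    (h.pow_le k hk).trans (hΛ.trans (by exact_mod_cast (Nat.lt_two_pow_self (n := m)).le))
  have h2 := le_of_pow_le_pow_left₀ h.m_pos.ne' zero_le_two h1
  rwa [div_le_iff₀ h.R_pos] at h2

/-- The normalisation that makes `peakSum` bounded in the weighted space. -/
noncomputable def peakScale (a : ℝ) (m n : ℕ) (R : ℝ) : ℝ :=
  Real.sqrt m / (R * m ^ 3 * (R ^ n * Real.exp (-R ^ a)))

theorem peakScale_pos {m n : ℕ} {R : ℝ} (hm : 0 < m) (hR : 0 < R) : 0 < peakScale a m n R := by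
  have : (0 : ℝ) < m := by exact_mod_cast hm
  unfold peakScale
  positivity

/-- Upper bounds for normalised peak sums. -/
theorem ThinFamily.norm_peakScale_mul_le {m n : ℕ} {A : Finset ℕ} {x : ℕ → ℂ} {R Λ δ ε : ℝ}
    (ha : 0 < a) (h : ThinFamily m A x R Λ δ) {C : ℝ} (hC0 : 0 ≤ C)
    (hC : ∀ z : ℂ, ∑ k ∈ A, ((1 + ‖z - x k‖ / (δ * R / m)) ^ 3)⁻¹ ≤ C)
    {c : ℕ → ℂ} (hc : ∀ k ∈ A, ‖c k‖ ≤ 1) (hε : 0 < ε) (hRa : R ^ a = (m * ε) ^ 2)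
    (hmε : 1 ≤ m * ε) (hn : a * R ^ a ≤ n) (hn' : n ≤ a * R ^ a + 1) (hmn : m ≤ n) (z : ℂ) :
    ‖(peakScale a m n R : ℂ) * peakSum m n A x c z‖ * Real.exp (-‖z‖ ^ a) ≤
      C * (1 + 2 * Λ / δ) ^ 3 * Real.exp ((4 * (1 / ε) + 1) ^ 2 / a ^ 2) *
        (Real.sqrt m / R) * profile R m ‖z‖ := by
  have hR := h.R_pos
  have hδ := h.δ_pos
  have hΛ := h.one_le
  have hm : (0 : ℝ) < m := by exact_mod_cast h.m_pos
  have hα := peakScale_pos (a := a) (n := n) h.m_pos hR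
  have h1 := h.norm_peakSum_le hC hc n z
  have h2 := pow_mul_max_mul_exp_le (K := 1 / ε) ha hR (norm_nonneg z)
    (by rw [hRa]; exact one_le_pow₀ hmε) hn hn' hmn
    (by rw [hRa]; exact le_of_eq (by field_simp)) (by positivity)
  rw [norm_mul, Complex.norm_real, Real.norm_of_nonneg hα.le]
  set E := Real.exp ((4 * (1 / ε) + 1) ^ 2 / a ^ 2)
  calc peakScale a m n R * ‖peakSum m n A x c z‖ * Real.exp (-‖z‖ ^ a)
      ≤ peakScale a m n R * (C * (1 + 2 * Λ / δ) ^ 3 * m ^ 3 *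
          (‖z‖ ^ n * max 1 (‖z‖ / R) ^ (3 * m))) * Real.exp (-‖z‖ ^ a) := by gcongr
    _ = peakScale a m n R * (C * (1 + 2 * Λ / δ) ^ 3 * m ^ 3) *
          (‖z‖ ^ n * max 1 (‖z‖ / R) ^ (3 * m) * Real.exp (-‖z‖ ^ a)) := by ring
    _ ≤ peakScale a m n R * (C * (1 + 2 * Λ / δ) ^ 3 * m ^ 3) *
          (E * (R ^ n * Real.exp (-R ^ a)) * profile R m ‖z‖) := by
        apply mul_le_mul_of_nonneg_left h2
        positivity
    _ = _ := by
        unfold peakScale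
        field_simp

/-- Lower bound for the size of a normalised peak sum, relative to the derivative of `S`, at a
zero of `S` in the thin annulus. -/
theorem le_peakScale_mul_div_deriv (ha : 0 < a) (ha' : a ≤ 2)
    (hpow : ∀ r : ℝ, 1 < r → φ r = r ^ a) {C ε : ℝ} (hC : 0 < C) (hε : 0 < ε) {m n k : ℕ}
    (hm : 0 < m) (hR : 1 < innerRadius a ε m) (hk : k ∈ annulus a ε l m)
    (hle : innerRadius a ε m ≤ ‖l k‖) (hle' : ‖l k‖ ≤ 2 * innerRadius a ε m)
    (hn : a * innerRadius a ε m ^ a ≤ n) (hn' : n ≤ a * innerRadius a ε m ^ a + 1)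
    (hd0 : deriv S (l k) ≠ 0) (hd : ‖deriv S (l k)‖ ≤ C * sineMajorant φ γ (l k)) :
    Real.exp (-((1 + 3 * a * ε ^ 2) ^ 2 / (a ^ 2 * ε ^ 2))) * (3 : ℝ) ^ (-|γ|) / (C * a * ε) *
        (innerRadius a ε m ^ γ / Real.sqrt m) ≤
      peakScale a m n (innerRadius a ε m) * m ^ 3 * ‖l k ^ n / deriv S (l k)‖ := by
  have hm' : (1 : ℝ) ≤ m := by exact_mod_cast hm
  have hRa := innerRadius_rpow (m := m) ha hε
  have hR1 := innerRadius_rpow_one_sub ha hε hm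
  set R := innerRadius a ε m with hRdef
  have hR0 : 0 < R := by linarith
  set L := ‖l k‖ with hL
  have hL0 : 0 < L := by linarith
  have hL1 : 1 < L := by linarith
  have hLa : L ^ a = (L ^ (a / 2)) ^ 2 := by
    rw [← Real.rpow_natCast, ← Real.rpow_mul hL0.le]
    congr 1
    push_cast
    ring
  have hk1 : m * ε ≤ L ^ (a / 2) := hk.1
  have hk2 : L ^ (a / 2) < (m + 1) * ε := hk.2
  -- `n` is within `O(m)` of `a L ^ a`, so that `t ^ n e^{-t^a}` at `L` is comparable to its value at `R`
  have hG : R ^ n * Real.exp (-R ^ a) * Real.exp (-((1 + 3 * a * ε ^ 2) ^ 2 / (a ^ 2 * ε ^ 2))) ≤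
      L ^ n * Real.exp (-L ^ a) := by
    have h1 := pow_mul_exp_neg_rpow_le ha hR0.le hL0 n
    have h2 : (n - a * L ^ a) ^ 2 / (a ^ 2 * L ^ a) ≤
        (1 + 3 * a * ε ^ 2) ^ 2 / (a ^ 2 * ε ^ 2) := by
      have e1 : (m * ε) ^ 2 ≤ L ^ a := by rw [hLa]; gcongr
      have e2 : L ^ a ≤ ((m + 1) * ε) ^ 2 := by rw [hLa]; gcongr
      rw [hRa] at hn hn'
      have e3 : |n - a * L ^ a| ≤ (1 + 3 * a * ε ^ 2) * m := by
        have f1 := mul_le_mul_of_nonneg_left e1 ha.le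
        have f2 := mul_le_mul_of_nonneg_left e2 ha.le
        have f3 : a * ((m + 1) * ε) ^ 2 ≤ a * (m * ε) ^ 2 + 3 * a * ε ^ 2 * m := by
          have : 0 ≤ a * ε ^ 2 * (m - 1) := by
            have := sub_nonneg.2 hm'
            positivity
          nlinarith
        have f4 : 0 ≤ 3 * a * ε ^ 2 * m := by positivity
        rw [abs_le]
        constructor <;> nlinarith
      have e4 : (n - a * L ^ a) ^ 2 ≤ ((1 + 3 * a * ε ^ 2) * m) ^ 2 := by
        rw [← sq_abs]; exact pow_le_pow_left₀ (abs_nonneg _) e3 2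
      calc (n - a * L ^ a) ^ 2 / (a ^ 2 * L ^ a)
          ≤ ((1 + 3 * a * ε ^ 2) * m) ^ 2 / (a ^ 2 * (m * ε) ^ 2) := by gcongr
        _ = _ := by field_simp
    rw [Real.exp_neg ((1 + 3 * a * ε ^ 2) ^ 2 / (a ^ 2 * ε ^ 2)), ← div_eq_mul_inv,
      div_le_iff₀ (Real.exp_pos _)]
    exact h1.trans (mul_le_mul_of_nonneg_left (Real.exp_le_exp.2 h2) (by positivity))
  set G := Real.exp (-((1 + 3 * a * ε ^ 2) ^ 2 / (a ^ 2 * ε ^ 2))) with hGdef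
  -- `1 + L` lies between `R` and `3 R`
  have hP : (3 : ℝ) ^ (-|γ|) * R ^ γ ≤ (1 + L) ^ γ := by
    have h1 := (rpow_bounds_of_mem_Icc (y := (1 + L) / R) (Y := 3) γ
      ((one_le_div hR0).2 (by linarith)) ((div_le_iff₀ hR0).2 (by linarith))).1
    rwa [Real.div_rpow (by positivity) hR0.le, le_div_iff₀ (Real.rpow_pos_of_pos hR0 γ)] at h1
  have hgpos : 0 < (1 + L) ^ γ := Real.rpow_pos_of_pos (by positivity) _
  have hρ : R / (a * (m * ε)) ≤ rho φ (l k) := by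
    rw [rho_of_one_lt ha hpow hL1]
    have : R ^ (1 - a / 2) ≤ L ^ (1 - a / 2) := Real.rpow_le_rpow hR0.le hle (by linarith)
    rw [hR1] at this
    calc R / (a * (m * ε)) = R / (m * ε) / a := by field_simp
      _ ≤ _ := by gcongr
  have hρ0 : 0 < rho φ (l k) := lt_of_lt_of_le (by positivity) hρ
  have hdpos : 0 < ‖deriv S (l k)‖ := norm_pos_iff.2 hd0
  have hd' : ‖deriv S (l k)‖ ≤ C * (Real.exp (L ^ a) / rho φ (l k) * (1 / (1 + L) ^ γ)) := by
    have := hd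
    rwa [sineMajorant, ← hL, hpow _ hL1] at this
  have hinv : Real.exp (-L ^ a) * (R / (a * (m * ε))) * ((3 : ℝ) ^ (-|γ|) * R ^ γ) / C ≤
      1 / ‖deriv S (l k)‖ := by
    have e1 : 1 / (C * (Real.exp (L ^ a) / rho φ (l k) * (1 / (1 + L) ^ γ))) =
        Real.exp (-L ^ a) * rho φ (l k) * (1 + L) ^ γ / C := by
      rw [Real.exp_neg]
      field_simp
    refine le_trans ?_ (one_div_le_one_div_of_le hdpos hd')
    rw [e1]
    gcongr
  have hs : Real.sqrt m * Real.sqrt m = m := Real.mul_self_sqrt (by positivity)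
  have hspos : 0 < Real.sqrt m := Real.sqrt_pos.2 (by linarith)
  rw [norm_div, norm_pow, ← hL]
  have hq : R ^ γ / Real.sqrt m = Real.sqrt m * R ^ γ / m := by
    rw [div_eq_div_iff hspos.ne' (by positivity)]
    linear_combination (-(R ^ γ)) * hs
  calc G * (3 : ℝ) ^ (-|γ|) / (C * a * ε) * (R ^ γ / Real.sqrt m)
      = Real.sqrt m / R * G * ((R / (a * (m * ε))) * ((3 : ℝ) ^ (-|γ|) * R ^ γ) / C) := by
        rw [hq]
        field_simp
    _ = Real.sqrt m / R / (R ^ n * Real.exp (-R ^ a)) * (R ^ n * Real.exp (-R ^ a) * G) *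
          ((R / (a * (m * ε))) * ((3 : ℝ) ^ (-|γ|) * R ^ γ) / C) := by
        field_simp
    _ ≤ Real.sqrt m / R / (R ^ n * Real.exp (-R ^ a)) * (L ^ n * Real.exp (-L ^ a)) *
          ((R / (a * (m * ε))) * ((3 : ℝ) ^ (-|γ|) * R ^ γ) / C) := by
        gcongr
    _ = Real.sqrt m / R / (R ^ n * Real.exp (-R ^ a)) * L ^ n *
          (Real.exp (-L ^ a) * (R / (a * (m * ε))) * ((3 : ℝ) ^ (-|γ|) * R ^ γ) / C) := by
        ring
    _ ≤ Real.sqrt m / R / (R ^ n * Real.exp (-R ^ a)) * L ^ n * (1 / ‖deriv S (l k)‖) := by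
        gcongr
    _ = _ := by
        unfold peakScale
        field_simp

end Sine

end Fock

/-! ### Peak functions with almost positive interpolation coefficients -/

namespace Fock

section Sine

variable {a γ : ℝ} {φ : ℝ → ℝ} {S : ℂ → ℂ} {l : ℕ → ℂ}

/-- Functions of norm `O(1)` in the weighted Fock space which are concentrated near the `m`-th thin
annulus and for which the interpolation coefficients `F(λ) / S'(λ)` at all zeros in that annulus
are almost positive, and as large as the norm permits. -/
theorem exists_peak_functions (ha : 0 < a) (ha' : a ≤ 2) (hφ : IsWeight φ)
    (hpow : ∀ r : ℝ, 1 < r → φ r = r ^ a) (hS : SineClass φ γ S)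
    (hl : IsOrdering (zeroSet S) l) {δ₀ : ℝ} (hδ₀ : 0 < δ₀)
    (hsep : ∀ R : ℝ, 1 < R → ∀ i j : ℕ, i ≠ j →
      R ≤ ‖l i‖ → R ≤ ‖l j‖ → δ₀ * (R ^ (1 - a / 2) / a) ≤ ‖l i - l j‖) :
    ∃ ε C c : ℝ, 0 < ε ∧ 0 < C ∧ 0 < c ∧ ∀ᶠ m : ℕ in atTop, ∃ F : ℂ → ℂ,
      Differentiable ℂ F ∧ (∀ z, ‖F z‖ ≤ C * Real.exp (‖z‖ ^ a)) ∧
      ∫⁻ z : ℂ, ‖F z‖ₑ ^ 2 * ENNReal.ofReal (Real.exp (-2 * φ ‖z‖)) ≤ ENNReal.ofReal C ∧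
      ∀ k ∈ annulus a ε l m, innerRadius a ε m ≤ ‖l k‖ ∧ ‖l k‖ ≤ 2 * innerRadius a ε m ∧
        ∃ t : ℝ, c * (innerRadius a ε m ^ γ / Real.sqrt m) ≤ t ∧
          ‖F (l k) / deriv S (l k) - t‖ ≤ t / 6 := by
  obtain ⟨C₀, hC₀, hsum⟩ := exists_sum_inv_cube_le
  obtain ⟨Cφ, hCφ, hφle⟩ := exists_exp_neg_le ha hφ hpow
  obtain ⟨CS, hCS, hderiv⟩ := hS.exists_deriv_bounds hφ hl
  set Λ := Real.exp (2 / a) with hΛ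
  have hΛ0 : 0 < Λ := Real.exp_pos _
  -- a small `ε` makes the separation `δ` large relative to the width of the annulus
  set ε : ℝ := δ₀ / (4 * Λ ^ 2 * a * (6 * C₀ + 1)) with hεdef
  have hε : 0 < ε := by positivity
  set δ := δ₀ / (a * ε) with hδ
  have hδ0 : 0 < δ := by positivity
  have hδε : 4 * Λ ^ 2 / δ = 1 / (6 * C₀ + 1) := by
    rw [hδ, hεdef]
    field_simp
  have hsmall : (4 * Λ ^ 2 / δ) ^ 3 * C₀ ≤ 1 / 6 := by
    rw [hδε]
    have h1 : (1 / (6 * C₀ + 1)) ^ 3 ≤ 1 / (6 * C₀ + 1) :=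
      pow_le_of_le_one (by positivity) (by rw [div_le_one (by positivity)]; linarith) (by norm_num)
    calc (1 / (6 * C₀ + 1)) ^ 3 * C₀ ≤ 1 / (6 * C₀ + 1) * C₀ := by gcongr
      _ ≤ 1 / 6 := by
        rw [one_div_mul_eq_div, div_le_iff₀ (by positivity)]
        linarith
  set K := C₀ * (1 + 2 * Λ / δ) ^ 3 * Real.exp ((4 * (1 / ε) + 1) ^ 2 / a ^ 2) with hK
  have hK0 : 0 < K := by positivity
  set c := Real.exp (-((1 + 3 * a * ε ^ 2) ^ 2 / (a ^ 2 * ε ^ 2))) * (3 : ℝ) ^ (-|γ|) /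
    (CS * a * ε) with hc
  have hc0 : 0 < c := by positivity
  refine ⟨ε, K / ε + (Cφ * K) ^ 2 * (4 * π), c, hε, by positivity, hc0, ?_⟩
  have hev : ∀ b : ℝ, ∀ᶠ m : ℕ in atTop, b ≤ m := fun b =>
    tendsto_natCast_atTop_atTop.eventually_ge_atTop b
  filter_upwards [eventually_ge_atTop 2, hev (2 / ε), hev (1 / (a * ε ^ 2)), hev Λ]
    with m hm2 hm3 hm4 hmΛ
  have hm : 0 < m := by omega
  have hm' : (0 : ℝ) < m := by exact_mod_cast hm
  have hmε : 2 ≤ m * ε := (div_le_iff₀ hε).1 hm3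
  have hmε1 : 1 ≤ m * ε := by linarith
  have hRge := le_innerRadius ha ha' hmε1
  have hR1 : 1 < innerRadius a ε m := by linarith
  have hRa := innerRadius_rpow (m := m) ha hε
  have hfin := annulus_finite (a := a) ha hS.entire hl ε m
  set A := hfin.toFinset with hA
  have hthin : ThinFamily m A l (innerRadius a ε m) Λ δ :=
    thinFamily_annulus ha hδ₀ hsep hε hm hR1 fun k hk => by simpa [hA] using hk
  set R := innerRadius a ε m with hR
  have hR0 : 0 < R := by linarith
  set n := ⌈a * R ^ a⌉₊ with hn
  have haR : 0 ≤ a * R ^ a := by positivity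
  have hn1 : a * R ^ a ≤ n := Nat.le_ceil _
  have hn2 : n ≤ a * R ^ a + 1 := (Nat.ceil_lt_add_one haR).le
  have hmn : m ≤ n := by
    have : (m : ℝ) ≤ n := by
      refine le_trans ?_ hn1
      rw [hRa]
      rw [div_le_iff₀ (by positivity)] at hm4
      nlinarith
    exact_mod_cast this
  choose c' hc' hc'' using fun k => exists_phase (l k ^ n / deriv S (l k))
  have hb := hthin.norm_peakScale_mul_le ha hC₀.le (hsum A l _ hthin.scale_pos hthin.sep)
    (c := c') (fun k _ => hc' k) hε hRa hmε1 hn1 hn2 hmn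
  have hs1 : Real.sqrt m ≤ m := by
    rw [Real.sqrt_le_left hm'.le]
    have : (1 : ℝ) ≤ m := by exact_mod_cast hm
    nlinarith
  refine ⟨fun z => (peakScale a m n R : ℂ) * peakSum m n A l c' z,
    (differentiable_peakSum _ _ _ _ _).const_mul _, fun z => ?_, ?_, fun k hk => ?_⟩
  · have h1 := hb z
    rw [Real.exp_neg, ← div_eq_mul_inv, div_le_iff₀ (Real.exp_pos _)] at h1
    refine h1.trans (mul_le_mul_of_nonneg_right ?_ (Real.exp_pos _).le)
    have h2 : Real.sqrt m / R ≤ 1 / ε := by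
      rw [div_le_div_iff₀ hR0 hε]
      nlinarith
    have h3 := profile_le_one hR0 (norm_nonneg z) m
    have h4 := profile_nonneg hR0 (norm_nonneg z) m
    calc K * (Real.sqrt m / R) * profile R m ‖z‖ ≤ K * (1 / ε) * 1 := by gcongr
      _ = K / ε := by ring
      _ ≤ _ := by
        have : 0 < (Cφ * K) ^ 2 * (4 * π) := by positivity
        linarith
  · refine (lintegral_sq_le_of_profile (B := Cφ * (K * (Real.sqrt m / R))) hR0 hm2
      fun z => ?_).trans (ENNReal.ofReal_le_ofReal ?_)
    · refine (mul_le_mul_of_nonneg_left (hφle ‖z‖ (norm_nonneg z)) (norm_nonneg _)).trans ?_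
      have := mul_le_mul_of_nonneg_left (hb z) hCφ.le
      refine le_trans (le_of_eq ?_) (this.trans (le_of_eq ?_)) <;> ring
    · have h1 : Real.sqrt m ^ 2 = m := Real.sq_sqrt hm'.le
      have h2 : (Cφ * (K * (Real.sqrt m / R))) ^ 2 * (4 * π * R ^ 2 / m) =
          (Cφ * K) ^ 2 * (4 * π) := by
        rw [mul_pow, mul_pow, div_pow, h1]
        field_simp
      rw [h2]
      have : 0 < K / ε := by positivity
      linarith
  · have hkA : k ∈ A := by simpa [hA] using hk
    have hle := hthin.le_norm k hkA
    have hle' := hthin.norm_le_two_mul hmΛ hkA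
    have hz := map_ordering_eq_zero hl k
    have hd0 := hS.deriv_ne_zero hφ hl _ hz
    have hα := peakScale_pos (a := a) (n := n) hm hR0
    refine ⟨hle, hle', peakScale a m n R * m ^ 3 * ‖l k ^ n / deriv S (l k)‖, ?_, ?_⟩
    · exact le_peakScale_mul_div_deriv ha ha' hpow hCS hε hm hR1 hk hle hle' hn1 hn2 hd0
        (hderiv _ hz).1
    · have h1 := hthin.norm_peakSum_sub_le (hsum A l _ hthin.scale_pos hthin.sep)
        (c := c') (fun k _ => hc' k) n hkA
      have h2 := hc'' k
      have e : (peakScale a m n R : ℂ) * peakSum m n A l c' (l k) / deriv S (l k) -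
          ((peakScale a m n R * m ^ 3 * ‖l k ^ n / deriv S (l k)‖ : ℝ) : ℂ) =
          peakScale a m n R * ((peakSum m n A l c' (l k) - c' k * m ^ 3 * l k ^ n) /
            deriv S (l k)) := by
        push_cast
        rw [← h2]
        ring
      rw [e, norm_mul, norm_div, Complex.norm_real, Real.norm_of_nonneg hα.le, norm_div, norm_pow]
      calc peakScale a m n R * (‖peakSum m n A l c' (l k) - c' k * m ^ 3 * l k ^ n‖ /
            ‖deriv S (l k)‖)
          ≤ peakScale a m n R * (‖l k‖ ^ n * (m ^ 3 * (1 / 6)) / ‖deriv S (l k)‖) := by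
            gcongr
            exact h1.trans (by gcongr)
        _ = _ := by ring

end Sine

end Fock

/-! ### The test functional outside the annulus -/

namespace Fock

/-- The part of the annulus `4R < |z| < 5R` at distance at least `s / 13` from the zeros of `S`. -/
def testSet (S : ℂ → ℂ) (R s : ℝ) : Set ℂ :=
  {z | 4 * R < ‖z‖ ∧ ‖z‖ < 5 * R ∧ s / 13 ≤ Metric.infDist z (zeroSet S)}

section Sine

variable {a γ β : ℝ} {φ : ℝ → ℝ} {S : ℂ → ℂ} {l : ℕ → ℂ}

theorem measurableSet_testSet (S : ℂ → ℂ) (R s : ℝ) : MeasurableSet (testSet S R s) :=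
  (measurableSet_lt measurable_const measurable_norm).inter
    ((measurableSet_lt measurable_norm measurable_const).inter
      (measurableSet_le measurable_const (Metric.continuous_infDist_pt _).measurable))

theorem volume_testSet_le (S : ℂ → ℂ) {R : ℝ} (hR : 0 < R) (s : ℝ) :
    volume (testSet S R s) ≤ ENNReal.ofReal (25 * π * R ^ 2) := by
  have hsub : testSet S R s ⊆ Metric.ball 0 (5 * R) := fun z hz => by
    simpa using hz.2.1
  refine (measure_mono hsub).trans (le_of_eq ?_)
  rw [Complex.volume_ball, ← ENNReal.ofReal_pow (by positivity),
    ← ENNReal.ofReal_coe_nnreal, NNReal.coe_real_pi, ← ENNReal.ofReal_mul (by positivity)]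
  congr 1
  ring

theorem volume_testSet_ne_top (S : ℂ → ℂ) {R : ℝ} (hR : 0 < R) (s : ℝ) :
    volume (testSet S R s) ≠ ∞ :=
  ((volume_testSet_le S hR s).trans_lt ENNReal.ofReal_lt_top).ne

/-- Removing small discs around separated zeros leaves most of the annulus. -/
theorem sq_le_volume_testSet (hS : Differentiable ℂ S) (hl : IsOrdering (zeroSet S) l) {R s : ℝ}
    (hs : 0 < s) (hsR : s ≤ R)
    (hsep : ∀ i j : ℕ, i ≠ j → R ≤ ‖l i‖ → R ≤ ‖l j‖ → s ≤ ‖l i - l j‖) :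
    R ^ 2 ≤ volume.real (testSet S R s) := by
  have hR : 0 < R := hs.trans_le hsR
  have hfin := finite_norm_le hS hl (6 * R)
  set B := hfin.toFinset.filter (fun k => R ≤ ‖l k‖) with hB
  have hBmem : ∀ k, k ∈ B ↔ ‖l k‖ ≤ 6 * R ∧ R ≤ ‖l k‖ := by
    intro k
    simp [hB]
  have hcard : (B.card : ℝ) * s ^ 2 ≤ (2 * (6 * R) + s) ^ 2 :=
    SepFamily.card_mul_sq_le hs (fun i hi j hj hij =>
      hsep i j hij ((hBmem i).1 hi).2 ((hBmem j).1 hj).2) (by positivity)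
      fun i hi => ((hBmem i).1 hi).1
  have hcover : Metric.ball (0 : ℂ) (5 * R) ⊆
      (testSet S R s ∪ Metric.closedBall 0 (4 * R)) ∪ ⋃ k ∈ B, Metric.ball (l k) (s / 13) := by
    intro z hz
    have hz5 : ‖z‖ < 5 * R := by simpa using hz
    by_cases h4 : ‖z‖ ≤ 4 * R
    · exact Or.inl (Or.inr (by simpa using h4))
    by_cases hd : s / 13 ≤ Metric.infDist z (zeroSet S)
    · exact Or.inl (Or.inl ⟨not_le.1 h4, hz5, hd⟩)
    right
    obtain ⟨w, hw, hlt⟩ := (Metric.infDist_lt_iff ⟨l 0, map_ordering_eq_zero hl 0⟩).1 (not_le.1 hd)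
    obtain ⟨k, rfl⟩ := exists_of_mem_zeroSet hl hw
    simp only [mem_iUnion]
    refine ⟨k, (hBmem k).2 ?_, hlt⟩
    rw [dist_eq_norm] at hlt
    have h1 := abs_le.1 (abs_norm_sub_norm_le z (l k))
    push Not at h4
    constructor <;> linarith [h1.1, h1.2]
  have hnt : ∀ (w : ℂ) (r : ℝ), volume (Metric.ball w r) ≠ ∞ := fun w r => by
    rw [Complex.volume_ball]
    exact ENNReal.mul_ne_top (by simp) (by simp)
  have hntc : volume (Metric.closedBall (0 : ℂ) (4 * R)) ≠ ∞ := by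
    rw [Complex.volume_closedBall]
    exact ENNReal.mul_ne_top (ENNReal.pow_ne_top ENNReal.ofReal_ne_top) (by simp)
  have hU : volume (⋃ k ∈ B, Metric.ball (l k) (s / 13)) ≠ ∞ :=
    (measure_biUnion_lt_top B.finite_toSet fun k _ => (hnt _ _).lt_top).ne
  have h1 := measureReal_mono (μ := volume) hcover (measure_union_ne_top
    (measure_union_ne_top (volume_testSet_ne_top S hR s) hntc) hU)
  have h2 := h1.trans (measureReal_union_le _ _)
  have h3 := measureReal_union_le (μ := volume) (testSet S R s) (Metric.closedBall (0 : ℂ) (4 * R))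
  have h4 := measureReal_biUnion_finset_le (μ := volume) B fun k => Metric.ball (l k) (s / 13)
  simp only [volume_real_ball _ (show 0 ≤ s / 13 by positivity), Finset.sum_const,
    nsmul_eq_mul] at h4
  rw [volume_real_ball _ (by positivity)] at h2
  rw [volume_real_closedBall _ (by positivity)] at h3
  have h5 : (2 * (6 * R) + s) ^ 2 ≤ (13 * R) ^ 2 := by
    apply pow_le_pow_left₀ (by positivity)
    linarith
  have h6 : (B.card : ℝ) * ((s / 13) ^ 2 * π) ≤ R ^ 2 * π := by
    have : (B.card : ℝ) * s ^ 2 ≤ (13 * R) ^ 2 := hcard.trans h5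
    nlinarith [Real.pi_pos]
  have h7 : R ^ 2 * 3 < R ^ 2 * π := by
    have := Real.pi_gt_three
    gcongr
  nlinarith

/-- On the test set, `|z| e^{φ_β}` is bounded by `|S|` times a power of `R`. -/
theorem exists_le_norm_on_testSet (ha : 0 < a) (ha' : a ≤ 2)
    (hpow : ∀ r : ℝ, 1 < r → φ r = r ^ a) (hφ : IsWeight φ) (hS : SineClass φ γ S) {δ₀ : ℝ}
    (hδ₀ : 0 < δ₀) (β : ℝ) :
    ∃ C : ℝ, 0 < C ∧ ∀ R : ℝ, 1 < R → ∀ z ∈ testSet S R (δ₀ * (R ^ (1 - a / 2) / a)),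
      ‖z‖ * Real.exp (modify φ β ‖z‖) ≤ C * R ^ (1 + γ + β) * ‖S z‖ := by
  obtain ⟨C, hC, h⟩ := hS.exists_bounds
  refine ⟨5 * (65 / δ₀ * C * 6 ^ |γ + β|), by positivity, fun R hR z hz => ?_⟩
  obtain ⟨hz4, hz5, hd⟩ := hz
  have hR0 : 0 < R := by linarith
  set L := ‖z‖ with hL
  have hL0 : 0 < L := by linarith
  have hg0 : 0 < (1 + L) ^ γ := Real.rpow_pos_of_pos (by positivity) _
  have hρ0 := rho_pos hφ z
  have hρ : rho φ z ≤ 5 * (R ^ (1 - a / 2) / a) := by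
    rw [rho_of_one_lt ha hpow (show 1 < ‖z‖ by linarith), ← hL]
    have h1 : L ^ (1 - a / 2) ≤ (5 * R) ^ (1 - a / 2) :=
      Real.rpow_le_rpow hL0.le hz5.le (by linarith)
    rw [Real.mul_rpow (by norm_num) hR0.le] at h1
    have h2 : (5 : ℝ) ^ (1 - a / 2) ≤ 5 := by
      conv_rhs => rw [← Real.rpow_one 5]
      exact Real.rpow_le_rpow_of_exponent_le (by norm_num) (by linarith)
    have h3 : 0 ≤ R ^ (1 - a / 2) := by positivity
    rw [← mul_div_assoc]
    gcongr
    exact h1.trans (mul_le_mul_of_nonneg_right h2 h3)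
  have hS1 : Real.exp (φ L) ≤ 65 / δ₀ * C * ‖S z‖ * (1 + L) ^ γ := by
    have h1 := (h z).2
    rw [sineMajorant, ← hL] at h1
    have h2 : δ₀ / 65 * rho φ z ≤ Metric.infDist z (zeroSet S) := by
      refine le_trans ?_ hd
      have := mul_le_mul_of_nonneg_left hρ (show 0 ≤ δ₀ / 65 by positivity)
      refine this.trans (le_of_eq ?_)
      ring
    have h3 : Real.exp (φ L) / rho φ z * (1 / (1 + L) ^ γ) * (δ₀ / 65 * rho φ z) ≤ C * ‖S z‖ :=
      (mul_le_mul_of_nonneg_left h2 (by positivity)).trans h1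
    have e : Real.exp (φ L) / rho φ z * (1 / (1 + L) ^ γ) * (δ₀ / 65 * rho φ z) =
        Real.exp (φ L) * δ₀ / (65 * (1 + L) ^ γ) := by
      field_simp
    rw [e, div_le_iff₀ (by positivity)] at h3
    rw [show 65 / δ₀ * C * ‖S z‖ * (1 + L) ^ γ = C * ‖S z‖ * (65 * (1 + L) ^ γ) / δ₀ by ring,
      le_div_iff₀ hδ₀]
    exact h3
  have hmod : Real.exp (modify φ β L) = Real.exp (φ L) * (1 + L) ^ β := by
    rw [modify, Real.exp_add, mul_comm β, Real.exp_mul, Real.exp_log (by positivity)]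
  have hpw : (1 + L) ^ γ * (1 + L) ^ β ≤ 6 ^ |γ + β| * R ^ (γ + β) := by
    rw [← Real.rpow_add (by positivity)]
    have h1 := (rpow_bounds_of_mem_Icc (y := (1 + L) / R) (Y := 6) (γ + β)
      ((one_le_div hR0).2 (by linarith)) ((div_le_iff₀ hR0).2 (by linarith))).2
    rwa [Real.div_rpow (by positivity) hR0.le, div_le_iff₀ (Real.rpow_pos_of_pos hR0 _)] at h1
  have hb0 : 0 < (1 + L) ^ β := Real.rpow_pos_of_pos (by positivity) _
  rw [hmod]
  calc L * (Real.exp (φ L) * (1 + L) ^ β)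
      ≤ 5 * R * (65 / δ₀ * C * ‖S z‖ * (1 + L) ^ γ * (1 + L) ^ β) := by gcongr
    _ = 5 * R * (65 / δ₀ * C * ‖S z‖) * ((1 + L) ^ γ * (1 + L) ^ β) := by ring
    _ ≤ 5 * R * (65 / δ₀ * C * ‖S z‖) * (6 ^ |γ + β| * R ^ (γ + β)) := by gcongr
    _ = _ := by
      rw [show 1 + γ + β = 1 + (γ + β) by ring, Real.rpow_add hR0 1, Real.rpow_one]
      ring

/-- The coefficients of the functional
`f ↦ ∫_E z ∑_{k ∈ A} f(λ_k) / (S'(λ_k) (z - λ_k)) dm(z)`, `E` the test set, as a combination of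
point evaluations at the zeros `λ_k`. -/
noncomputable def testWeight (S : ℂ → ℂ) (l : ℕ → ℂ) (R s : ℝ) (k : ℕ) : ℂ :=
  (∫ z in testSet S R s, z / (z - l k)) / deriv S (l k)

theorem norm_div_sub_le {R s : ℝ} {z : ℂ} (hz : z ∈ testSet S R s) {w : ℂ} (hw : ‖w‖ ≤ 2 * R) :
    ‖z / (z - w)‖ ≤ 2 := by
  have h1 := norm_sub_norm_le z w
  have h2 := hz.1
  have h3 : 0 < ‖z - w‖ := by
    have := norm_nonneg w
    linarith
  rw [norm_div, div_le_iff₀ h3]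
  linarith

theorem half_le_re_div_sub {R s : ℝ} {z : ℂ} (hz : z ∈ testSet S R s) {w : ℂ}
    (hw : ‖w‖ ≤ 2 * R) : 1 / 2 ≤ (z / (z - w)).re := by
  have h2 := hz.1
  have hw0 := norm_nonneg w
  have h1 := norm_sub_norm_le z w
  have hz0 : 0 < ‖z‖ := by linarith
  have h3 : 0 < ‖z - w‖ := by linarith
  have hq : 0 < Complex.normSq (z - w) := Complex.normSq_pos.2 (norm_pos_iff.1 h3)
  have h4 : Complex.normSq w ≤ Complex.normSq z := by
    rw [Complex.normSq_eq_norm_sq, Complex.normSq_eq_norm_sq]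
    exact pow_le_pow_left₀ hw0 (by linarith) 2
  rw [Complex.div_re, ← add_div, le_div_iff₀ hq]
  simp only [Complex.normSq_apply, Complex.sub_re, Complex.sub_im] at h4 ⊢
  nlinarith

theorem integrableOn_div_sub {R s : ℝ} (hR : 0 < R) {w : ℂ} (hw : ‖w‖ ≤ 2 * R) :
    IntegrableOn (fun z => z / (z - w)) (testSet S R s) :=
  Measure.integrableOn_of_bounded (M := 2) (volume_testSet_ne_top S hR s)
    (measurable_id.div (measurable_id.sub_const w)).aestronglyMeasurable ((ae_restrict_mem (measurableSet_testSet S R s)).mono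
      fun _ hz => norm_div_sub_le hz hw)

/-- If the coefficients are almost positive, no cancellation occurs in the test functional. -/
theorem le_norm_sum_testWeight_mul {R s : ℝ} (hR : 0 < R)
    (hE : R ^ 2 ≤ volume.real (testSet S R s)) {A : Finset ℕ} (hA : ∀ k ∈ A, ‖l k‖ ≤ 2 * R)
    {F : ℂ → ℂ} {c : ℝ} (hc : 0 ≤ c)
    (hF : ∀ k ∈ A, ∃ t : ℝ, c ≤ t ∧ ‖F (l k) / deriv S (l k) - t‖ ≤ t / 6) :
    A.card * (c / 6) * R ^ 2 ≤ ‖∑ k ∈ A, testWeight S l R s k * F (l k)‖ := by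
  set E := testSet S R s with hEdef
  have hEm : MeasurableSet E := measurableSet_testSet S R s
  have hterm : ∀ k ∈ A, c / 6 * R ^ 2 ≤ (testWeight S l R s k * F (l k)).re := by
    intro k hk
    obtain ⟨t, hct, ht⟩ := hF k hk
    set v := F (l k) / deriv S (l k) with hv
    have hint := integrableOn_div_sub (S := S) (s := s) hR (hA k hk)
    have e : testWeight S l R s k * F (l k) = ∫ z in E, v * (z / (z - l k)) := by
      rw [integral_const_mul, testWeight, hv]
      ring
    have hre : (∫ z in E, v * (z / (z - l k))).re = ∫ z in E, (v * (z / (z - l k))).re :=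
      (integral_re (hint.const_mul v)).symm
    rw [e, hre]
    have hpt : ∀ z ∈ E, c / 6 ≤ (v * (z / (z - l k))).re := by
      intro z hz
      have h1 := half_le_re_div_sub hz (hA k hk)
      have h2 := norm_div_sub_le hz (hA k hk)
      set q := z / (z - l k)
      have h3 : (v * q).re = t * q.re + ((v - t) * q).re := by
        rw [← Complex.re_ofReal_mul, ← Complex.add_re]
        congr 1
        ring
      have h4 : |((v - t) * q).re| ≤ t / 6 * 2 := by
        refine (Complex.abs_re_le_norm _).trans ?_
        rw [norm_mul]
        exact mul_le_mul ht h2 (norm_nonneg _) ((norm_nonneg _).trans ht)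
      have h5 := (abs_le.1 h4).1
      have h6 : t * (1 / 2) ≤ t * q.re := mul_le_mul_of_nonneg_left h1 (hc.trans hct)
      rw [h3]
      linarith
    have h7 : ∫ z in E, c / 6 ≤ ∫ z in E, (v * (z / (z - l k))).re :=
      setIntegral_mono_on (integrableOn_const (volume_testSet_ne_top S hR s))
        (hint.const_mul v).re hEm hpt
    rw [setIntegral_const, smul_eq_mul] at h7
    have h8 : R ^ 2 * (c / 6) ≤ volume.real E * (c / 6) :=
      mul_le_mul_of_nonneg_right hE (by positivity)
    linarith
  refine le_trans ?_ ((le_abs_self _).trans (Complex.abs_re_le_norm _))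
  rw [Complex.re_sum]
  have := Finset.sum_le_sum hterm
  rw [Finset.sum_const, nsmul_eq_mul] at this
  linarith

/-- Cauchy–Schwarz on a set of finite measure. -/
theorem setLIntegral_le_weightedNorm {ψ : ℝ → ℝ} (hψ : Continuous (radial ψ)) {g : ℂ → ℂ}
    (hg : Measurable g) (E : Set ℂ) :
    ∫⁻ z in E, ‖g z‖ₑ * ENNReal.ofReal (Real.exp (-ψ ‖z‖)) ≤
      volume E ^ (1 / 2 : ℝ) * weightedNorm ψ g := by
  set h : ℂ → ℝ≥0∞ := fun z => ‖g z‖ₑ * ENNReal.ofReal (Real.exp (-ψ ‖z‖)) with hh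
  have hm : Measurable h :=
    hg.enorm.mul (Real.continuous_exp.comp hψ.neg).measurable.ennreal_ofReal
  have h1 := ENNReal.lintegral_mul_le_Lp_mul_Lq (volume.restrict E)
    (p := 2) (q := 2) (by constructor <;> norm_num)
    (aemeasurable_const (b := (1 : ℝ≥0∞))) hm.aemeasurable
  simp only [Pi.mul_apply, one_mul, ENNReal.one_rpow, lintegral_const, Measure.restrict_apply,
    MeasurableSet.univ, univ_inter] at h1
  refine h1.trans (mul_le_mul_right ?_ _)
  unfold weightedNorm
  apply ENNReal.rpow_le_rpow _ (by norm_num)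
  refine (setLIntegral_le_lintegral _ _).trans (lintegral_mono fun z => ?_)
  simp only [hh]
  rw [show (2 : ℝ) = ((2 : ℕ) : ℝ) by norm_num, ENNReal.rpow_natCast, mul_pow,
    ← ENNReal.ofReal_pow (Real.exp_pos _).le, ← Real.exp_nat_mul]
  apply le_of_eq
  congr 3
  push_cast
  ring

theorem lagrangeSum_sub {f : ℂ → ℂ} {M N : ℕ} (hMN : M ≤ N) (z : ℂ) :
    lagrangeSum S l f N z - lagrangeSum S l f M z =
      S z * ∑ k ∈ Finset.Ico M N, f (l k) / (deriv S (l k) * (z - l k)) := by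
  rw [lagrangeSum, lagrangeSum, ← mul_sub, Finset.sum_Ico_eq_sub _ hMN]

theorem measurable_sub_lagrangeSum (hS : Differentiable ℂ S) {f : ℂ → ℂ}
    (hf : Differentiable ℂ f) (N : ℕ) : Measurable fun z => f z - lagrangeSum S l f N z := by
  have h1 := hS.continuous.measurable
  have h2 := hf.continuous.measurable
  unfold lagrangeSum
  fun_prop

/-- The test functional is dominated by the weighted norm of the increments of the interpolation
series. -/
theorem enorm_sum_testWeight_mul_le (hφ : IsWeight φ) (hS : Differentiable ℂ S) {R s B : ℝ}
    (hR : 0 < R) (hB0 : 0 ≤ B)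
    (hB : ∀ z ∈ testSet S R s, ‖z‖ * Real.exp (modify φ β ‖z‖) ≤ B * ‖S z‖) {M N : ℕ}
    (hMN : M ≤ N) (hA : ∀ k ∈ Finset.Ico M N, ‖l k‖ ≤ 2 * R) {f : ℂ → ℂ}
    (hf : Differentiable ℂ f) :
    ‖∑ k ∈ Finset.Ico M N, testWeight S l R s k * f (l k)‖ₑ ≤
      ENNReal.ofReal B * (ENNReal.ofReal (25 * π * R ^ 2) ^ (1 / 2 : ℝ) *
        (weightedNorm (modify φ β) (fun z => f z - lagrangeSum S l f N z) +
          weightedNorm (modify φ β) (fun z => f z - lagrangeSum S l f M z))) := by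
  set E := testSet S R s with hE
  set ψ := modify φ β with hψ
  have hψc : Continuous (radial ψ) := by
    have h1 : Continuous (radial φ) := hφ.contDiff.continuous
    have h2 : ∀ z : ℂ, 1 + ‖z‖ ≠ 0 := fun z => by positivity
    have h3 : Continuous fun z : ℂ => Real.log (1 + ‖z‖) :=
      (continuous_const.add continuous_norm).log h2
    exact h1.add (h3.const_mul β)
  set G : ℂ → ℂ := fun z => ∑ k ∈ Finset.Ico M N, f (l k) / deriv S (l k) * (z / (z - l k)) with hG
  have hint : ∀ k ∈ Finset.Ico M N,
      IntegrableOn (fun z => f (l k) / deriv S (l k) * (z / (z - l k))) E := fun k hk =>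
    (integrableOn_div_sub hR (hA k hk)).const_mul _
  have e1 : ∑ k ∈ Finset.Ico M N, testWeight S l R s k * f (l k) = ∫ z in E, G z := by
    rw [hG, integral_finsetSum _ hint]
    refine Finset.sum_congr rfl fun k _ => ?_
    rw [integral_const_mul, testWeight]
    ring
  rw [e1]
  refine (enorm_integral_le_lintegral_enorm _).trans ?_
  set W : ℂ → ℝ≥0∞ := fun z => ENNReal.ofReal (Real.exp (-ψ ‖z‖)) with hW
  set gN : ℂ → ℂ := fun z => f z - lagrangeSum S l f N z with hgN
  set gM : ℂ → ℂ := fun z => f z - lagrangeSum S l f M z with hgM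
  have hpt : ∀ z ∈ E, ‖G z‖ₑ ≤ ENNReal.ofReal B * (‖gN z‖ₑ * W z + ‖gM z‖ₑ * W z) := by
    intro z hz
    set H := ∑ k ∈ Finset.Ico M N, f (l k) / (deriv S (l k) * (z - l k)) with hH
    have e2 : G z = z * H := by
      rw [hG, hH, Finset.mul_sum]
      refine Finset.sum_congr rfl fun k _ => ?_
      rw [div_mul_div_comm, ← mul_div_assoc, mul_comm (f (l k)) z]
    have e3 : gM z - gN z = S z * H := by
      rw [hgM, hgN, hH, ← lagrangeSum_sub hMN]
      ring
    have h1 : ‖G z‖ ≤ B * ((‖gN z‖ + ‖gM z‖) * Real.exp (-ψ ‖z‖)) := by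
      have hb := hB z hz
      have h2 : ‖z‖ ≤ B * ‖S z‖ * Real.exp (-ψ ‖z‖) := by
        rw [Real.exp_neg, ← div_eq_mul_inv, le_div_iff₀ (Real.exp_pos _)]
        exact hb
      have h3 : ‖S z‖ * ‖H‖ ≤ ‖gN z‖ + ‖gM z‖ := by
        rw [← norm_mul, ← e3, add_comm]
        exact norm_sub_le _ _
      calc ‖G z‖ = ‖z‖ * ‖H‖ := by rw [e2, norm_mul]
        _ ≤ B * ‖S z‖ * Real.exp (-ψ ‖z‖) * ‖H‖ := by gcongr
        _ = B * (‖S z‖ * ‖H‖ * Real.exp (-ψ ‖z‖)) := by ring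
        _ ≤ _ := by gcongr
    rw [← ofReal_norm (G z)]
    refine (ENNReal.ofReal_le_ofReal h1).trans (le_of_eq ?_)
    rw [ENNReal.ofReal_mul hB0, ENNReal.ofReal_mul (by positivity),
      ENNReal.ofReal_add (norm_nonneg _) (norm_nonneg _), ofReal_norm, ofReal_norm, add_mul]
  have hmN : Measurable gN := measurable_sub_lagrangeSum hS hf N
  have hmM : Measurable gM := measurable_sub_lagrangeSum hS hf M
  have hWm : Measurable W := (Real.continuous_exp.comp hψc.neg).measurable.ennreal_ofReal
  have hv : volume E ^ (1 / 2 : ℝ) ≤ ENNReal.ofReal (25 * π * R ^ 2) ^ (1 / 2 : ℝ) :=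
    ENNReal.rpow_le_rpow (volume_testSet_le S hR s) (by norm_num)
  calc ∫⁻ z in E, ‖G z‖ₑ
      ≤ ∫⁻ z in E, ENNReal.ofReal B * (‖gN z‖ₑ * W z + ‖gM z‖ₑ * W z) :=
        setLIntegral_mono' (measurableSet_testSet S R s) hpt
    _ = ENNReal.ofReal B * ((∫⁻ z in E, ‖gN z‖ₑ * W z) + ∫⁻ z in E, ‖gM z‖ₑ * W z) := by
        rw [lintegral_const_mul' _ _ ENNReal.ofReal_ne_top, lintegral_add_left (f := fun z => ‖gN z‖ₑ * W z)
          (hmN.enorm.mul hWm)]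
    _ ≤ ENNReal.ofReal B * (volume E ^ (1 / 2 : ℝ) * weightedNorm ψ gN +
          volume E ^ (1 / 2 : ℝ) * weightedNorm ψ gM) := by
        gcongr
        · exact setLIntegral_le_weightedNorm hψc hmN E
        · exact setLIntegral_le_weightedNorm hψc hmM E
    _ ≤ _ := by
        rw [← mul_add]
        gcongr

end Sine

end Fock

/-! ### Divergence of the interpolation series -/

namespace Fock

section Sine

variable {a γ β : ℝ} {φ : ℝ → ℝ} {S : ℂ → ℂ} {l : ℕ → ℂ}

/-- The first index `k` with `b ≤ |λ_k|^{a/2}`. -/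
noncomputable def firstIndex (a : ℝ) (l : ℕ → ℂ) (b : ℝ) : ℕ := sInf {k | b ≤ ‖l k‖ ^ (a / 2)}

theorem firstIndex_le_iff (ha : 0 < a) (hS : Differentiable ℂ S) (hl : IsOrdering (zeroSet S) l)
    (b : ℝ) (k : ℕ) : firstIndex a l b ≤ k ↔ b ≤ ‖l k‖ ^ (a / 2) := by
  have hmono : ∀ i j, i ≤ j → ‖l i‖ ^ (a / 2) ≤ ‖l j‖ ^ (a / 2) := fun i j hij =>
    Real.rpow_le_rpow (norm_nonneg _) (hl.norm_monotone hij) (by positivity)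
  have hne : {k | b ≤ ‖l k‖ ^ (a / 2)}.Nonempty := by
    by_contra h
    rw [Set.not_nonempty_iff_eq_empty] at h
    refine Set.infinite_univ ((finite_norm_le hS hl (|b| ^ (2 / a))).subset fun k _ => ?_)
    have hk : ‖l k‖ ^ (a / 2) < b := by
      by_contra hk
      have : k ∈ {k | b ≤ ‖l k‖ ^ (a / 2)} := not_lt.1 hk
      rw [h] at this
      exact this
    have h1 := Real.rpow_le_rpow (by positivity) (hk.le.trans (le_abs_self b))
      (show 0 ≤ 2 / a by positivity)
    rwa [← Real.rpow_mul (norm_nonneg _), show a / 2 * (2 / a) = 1 by field_simp,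
      Real.rpow_one] at h1
  constructor
  · intro h
    have h1 : firstIndex a l b ∈ {k | b ≤ ‖l k‖ ^ (a / 2)} := Nat.sInf_mem hne
    exact le_trans (show b ≤ _ from h1) (hmono _ _ h)
  · intro h
    exact Nat.sInf_le h

theorem mem_Ico_firstIndex (ha : 0 < a) (hS : Differentiable ℂ S) (hl : IsOrdering (zeroSet S) l)
    (ε : ℝ) (m k : ℕ) :
    k ∈ Finset.Ico (firstIndex a l (m * ε)) (firstIndex a l ((m + 1) * ε)) ↔
      k ∈ annulus a ε l m := by
  rw [Finset.mem_Ico, ← not_le, firstIndex_le_iff ha hS hl, firstIndex_le_iff ha hS hl, not_le]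
  rfl

theorem firstIndex_mono (ha : 0 < a) (hS : Differentiable ℂ S) (hl : IsOrdering (zeroSet S) l)
    {b b' : ℝ} (h : b ≤ b') : firstIndex a l b ≤ firstIndex a l b' :=
  (firstIndex_le_iff ha hS hl b _).2 (h.trans ((firstIndex_le_iff ha hS hl b' _).1 le_rfl))

theorem card_Ico_firstIndex (ha : 0 < a) (hS : Differentiable ℂ S)
    (hl : IsOrdering (zeroSet S) l) (ε : ℝ) (m : ℕ) :
    (Finset.Ico (firstIndex a l (m * ε)) (firstIndex a l ((m + 1) * ε))).card =
      (annulus a ε l m).ncard := by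
  rw [← Set.ncard_coe_finset]
  congr 1
  ext k
  exact mem_Ico_firstIndex ha hS hl ε m k

end Sine

end Fock

theorem theorem3 (a : ℝ) (ha : 0 < a) (ha' : a ≤ 2)
    (φ : ℝ → ℝ) (hφ : Fock.IsWeight φ) (hpow : ∀ r : ℝ, 1 < r → φ r = r ^ a)
    (β : ℝ) (hβ : 0 ≤ β) (hβ' : β < a / 4) (γ : ℝ)
    (S : ℂ → ℂ) (hS : Fock.SineClass φ γ S)
    (l : ℕ → ℂ) (hl : Fock.IsOrdering (Fock.zeroSet S) l) :
    ∃ f ∈ Fock.space φ,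
      ¬ Tendsto (fun N : ℕ => Fock.weightedNorm (Fock.modify φ β) (fun z => f z - Fock.lagrangeSum S l f N z))
        atTop (𝓝 0) := by
  have hSd := hS.entire
  obtain ⟨δ₀, hδ₀, hsep⟩ := Fock.exists_separation ha ha' hpow hφ hS hl
  obtain ⟨ε, C, c, hε, hC, hc, hpeak⟩ :=
    Fock.exists_peak_functions ha ha' hφ hpow hS hl hδ₀ hsep
  obtain ⟨C₁, hC₁, htest⟩ := Fock.exists_le_norm_on_testSet ha ha' hpow hφ hS hδ₀ β
  -- half of the room left by `β < a / 4`
  set τ := (1 / 2 - 2 * β / a) / 2 with hτdef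
  have hβa : 2 * β / a < 1 / 2 := by
    rw [div_lt_iff₀ ha]
    linarith
  have hβa0 : 0 ≤ 2 * β / a := by positivity
  have hτ : 0 < τ := by linarith
  have hev : ∀ b : ℝ, ∀ᶠ m : ℕ in atTop, b ≤ m := fun b =>
    tendsto_natCast_atTop_atTop.eventually_ge_atTop b
  obtain ⟨q, hq, hprop⟩ := extraction_of_frequently_atTop
    ((hS.frequently_le_ncard_annulus ha ha' hφ hpow hl hε hτ (by linarith)).and_eventually
      (hpeak.and ((hev (2 / ε)).and (hev (δ₀ / (a * ε))))))
  choose hcount hF' hq2 hqδ using hprop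
  choose F hFd hFb hFn hFA using hF'
  set R : ℕ → ℝ := fun i => Fock.innerRadius a ε (q i) with hR
  have hqε : ∀ i, 2 ≤ q i * ε := fun i => (div_le_iff₀ hε).1 (hq2 i)
  have hq0 : ∀ i, 0 < q i := fun i => by
    rcases Nat.eq_zero_or_pos (q i) with h | h
    · have := hqε i
      rw [h] at this
      norm_num at this
    · exact h
  have hR1 : ∀ i, 1 < R i := fun i => by
    have h1 := hqε i
    have h2 := Fock.le_innerRadius (a := a) (ε := ε) (m := q i) ha ha' (by linarith)
    simp only [hR]
    linarith
  have hR0 : ∀ i, 0 < R i := fun i => by linarith [hR1 i]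
  set s : ℕ → ℝ := fun i => δ₀ * (R i ^ (1 - a / 2) / a) with hs
  have hs0 : ∀ i, 0 < s i := fun i => by
    have := Real.rpow_pos_of_pos (hR0 i) (1 - a / 2)
    simp only [hs]
    positivity
  have hsR : ∀ i, s i ≤ R i := fun i => by
    have hq' : (0 : ℝ) < q i := by exact_mod_cast hq0 i
    have h1 := hqδ i
    simp only [hs, hR]
    rw [Fock.innerRadius_rpow_one_sub ha hε (hq0 i)]
    rw [div_le_iff₀ (by positivity)] at h1
    have hR0' := Fock.innerRadius_pos (a := a) hε (hq0 i)
    rw [show δ₀ * (Fock.innerRadius a ε (q i) / (q i * ε) / a) =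
      Fock.innerRadius a ε (q i) * (δ₀ / (q i * (a * ε))) by field_simp]
    apply mul_le_of_le_one_right hR0'.le
    rw [div_le_one (by positivity)]
    exact h1
  have hE : ∀ i, R i ^ 2 ≤ volume.real (Fock.testSet S (R i) (s i)) := fun i =>
    Fock.sq_le_volume_testSet hSd hl (hs0 i) (hsR i) (hsep (R i) (hR1 i))
  set M : ℕ → ℕ := fun i => Fock.firstIndex a l (q i * ε) with hM
  set N : ℕ → ℕ := fun i => Fock.firstIndex a l ((q i + 1) * ε) with hN
  have hMN : ∀ i, M i ≤ N i := fun i =>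
    Fock.firstIndex_mono ha hSd hl (by nlinarith)
  have hmem : ∀ i k, k ∈ Finset.Ico (M i) (N i) → k ∈ Fock.annulus a ε l (q i) := fun i k hk =>
    (Fock.mem_Ico_firstIndex ha hSd hl ε (q i) k).1 hk
  have hl2 : ∀ i, ∀ k ∈ Finset.Ico (M i) (N i), ‖l k‖ ≤ 2 * R i := fun i k hk =>
    (hFA i k (hmem i k hk)).2.1
  set w : ℕ → ℕ → ℂ := fun i k =>
    ((R i ^ (-(2 + γ + β)) : ℝ) : ℂ) * Fock.testWeight S l (R i) (s i) k with hw
  have hfactor : ∀ i (f : ℂ → ℂ), ∑ k ∈ Finset.Ico (M i) (N i), w i k * f (l k) =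
      ((R i ^ (-(2 + γ + β)) : ℝ) : ℂ) *
        ∑ k ∈ Finset.Ico (M i) (N i), Fock.testWeight S l (R i) (s i) k * f (l k) := by
    intro i f
    simp only [hw, mul_assoc, Finset.mul_sum]
  -- the functionals grow along the peak functions
  have hlow : ∀ i, c / 6 * ε ^ (-(2 * β / a)) * (q i : ℝ) ^ τ ≤
      ‖∑ k ∈ Finset.Ico (M i) (N i), w i k * F i (l k)‖ := by
    intro i
    have hq' : (0 : ℝ) < q i := by exact_mod_cast hq0 i
    have hRγ : 0 < R i ^ γ := Real.rpow_pos_of_pos (hR0 i) _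
    have hRp : 0 < R i ^ (-(2 + γ + β)) := Real.rpow_pos_of_pos (hR0 i) _
    have h1 := Fock.le_norm_sum_testWeight_mul (l := l) (F := F i) (hR0 i) (hE i) (hl2 i)
      (c := c * (R i ^ γ / Real.sqrt (q i))) (by positivity)
      fun k hk => (hFA i k (hmem i k hk)).2.2
    rw [hfactor, norm_mul, Complex.norm_real, Real.norm_of_nonneg hRp.le]
    have hcard : (q i : ℝ) ^ (1 - τ) ≤ ((Finset.Ico (M i) (N i)).card : ℝ) := by
      rw [Fock.card_Ico_firstIndex ha hSd hl ε (q i)]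
      exact hcount i
    have hRβ : R i ^ (-(2 + γ + β)) * (R i ^ γ * R i ^ 2) = ε ^ (-(2 * β / a)) *
        (q i : ℝ) ^ (-(2 * β / a)) := by
      rw [← Real.rpow_natCast, ← Real.rpow_add (hR0 i), ← Real.rpow_add (hR0 i),
        show -(2 + γ + β) + (γ + ((2 : ℕ) : ℝ)) = -β by push_cast; ring,
        ← Real.mul_rpow hε.le hq'.le, mul_comm ε]
      simp only [hR, Fock.innerRadius]
      rw [← Real.rpow_mul (by positivity)]
      congr 1
      ring
    have hqp : (q i : ℝ) ^ τ = (q i : ℝ) ^ (1 - τ) / Real.sqrt (q i) *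
        (q i : ℝ) ^ (-(2 * β / a)) := by
      rw [Real.sqrt_eq_rpow, ← Real.rpow_sub hq', ← Real.rpow_add hq']
      congr 1
      rw [hτdef]
      ring
    calc c / 6 * ε ^ (-(2 * β / a)) * (q i : ℝ) ^ τ
        = (q i : ℝ) ^ (1 - τ) * (c / Real.sqrt (q i) / 6) *
            (ε ^ (-(2 * β / a)) * (q i : ℝ) ^ (-(2 * β / a))) := by
          rw [hqp]
          ring
      _ = R i ^ (-(2 + γ + β)) * ((q i : ℝ) ^ (1 - τ) *
            (c * (R i ^ γ / Real.sqrt (q i)) / 6) * R i ^ 2) := by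
          rw [← hRβ]
          ring
      _ ≤ R i ^ (-(2 + γ + β)) * (((Finset.Ico (M i) (N i)).card : ℝ) *
            (c * (R i ^ γ / Real.sqrt (q i)) / 6) * R i ^ 2) := by gcongr
      _ ≤ _ := mul_le_mul_of_nonneg_left h1 hRp.le
  have hqtop : Tendsto (fun i => (q i : ℝ)) atTop atTop :=
    tendsto_natCast_atTop_atTop.comp hq.tendsto_atTop
  have hunb : ∀ B : ℝ, ∃ i, B < ‖∑ k ∈ Finset.Ico (M i) (N i), w i k * F i (l k)‖ := by
    intro B
    have hε' : 0 < ε ^ (-(2 * β / a)) := Real.rpow_pos_of_pos hε _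
    have h1 : Tendsto (fun i => c / 6 * ε ^ (-(2 * β / a)) * (q i : ℝ) ^ τ) atTop atTop :=
      ((tendsto_rpow_atTop hτ).comp hqtop).const_mul_atTop (by positivity)
    obtain ⟨i, hi⟩ := (h1.eventually_gt_atTop B).exists
    exact ⟨i, hi.trans_le (hlow i)⟩
  obtain ⟨f, hf, hfu⟩ := Fock.exists_mem_space_unbounded (φ := φ) hφ.contDiff.continuous hFd
    (fun r => ⟨C * Real.exp (|r| ^ a), fun i z hz => (hFb i z).trans (by
      have := hz.trans (le_abs_self r)
      gcongr)⟩) ENNReal.ofReal_ne_top hFn (fun i => Finset.Ico (M i) (N i)) l w hunb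
  refine ⟨f, hf, fun hlim => ?_⟩
  -- convergence would bound the functionals at `f`
  obtain ⟨N₀, hN₀⟩ := eventually_atTop.1 (hlim.eventually_le_const one_pos)
  obtain ⟨i₀, hi₀⟩ := eventually_atTop.1
    ((hqtop.atTop_mul_const hε).eventually_gt_atTop (‖l N₀‖ ^ (a / 2)))
  set D : ℝ := C₁ * (Real.sqrt (25 * π) * 2) with hD
  have hD0 : 0 ≤ D := by positivity
  have hbound : ∀ i, i₀ ≤ i → ‖∑ k ∈ Finset.Ico (M i) (N i), w i k * f (l k)‖ ≤ D := by
    intro i hi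
    have hRp : 0 < R i ^ (-(2 + γ + β)) := Real.rpow_pos_of_pos (hR0 i) _
    have hRp' : 0 < R i ^ (1 + γ + β) := Real.rpow_pos_of_pos (hR0 i) _
    have hMi : N₀ ≤ M i := by
      by_contra hlt
      push Not at hlt
      exact absurd ((Fock.firstIndex_le_iff ha hSd hl _ _).1 hlt.le) (not_le.2 (hi₀ i hi))
    have h1 := Fock.enorm_sum_testWeight_mul_le (l := l) (β := β) hφ hSd (hR0 i)
      (B := C₁ * R i ^ (1 + γ + β)) (by positivity)
      (htest (R i) (hR1 i)) (hMN i) (hl2 i) hf.1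
    have h2 := h1.trans (mul_le_mul_right (mul_le_mul_right
      (add_le_add (hN₀ _ (hMi.trans (hMN i))) (hN₀ _ hMi)) _) _)
    rw [one_add_one_eq_two, ENNReal.ofReal_rpow_of_nonneg (by positivity) (by norm_num),
      show (2 : ℝ≥0∞) = ENNReal.ofReal 2 by simp, ← ENNReal.ofReal_mul (by positivity),
      ← ENNReal.ofReal_mul (by positivity), ← ofReal_norm,
      ENNReal.ofReal_le_ofReal_iff (by positivity), ← Real.sqrt_eq_rpow,
      Real.sqrt_mul (by positivity), Real.sqrt_sq (hR0 i).le] at h2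
    rw [hfactor, norm_mul, Complex.norm_real, Real.norm_of_nonneg hRp.le]
    refine (mul_le_mul_of_nonneg_left h2 hRp.le).trans (le_of_eq ?_)
    have h3 : R i ^ (-(2 + γ + β)) * (R i ^ (1 + γ + β) * R i) = 1 := by
      nth_rewrite 3 [← Real.rpow_one (R i)]
      rw [← Real.rpow_add (hR0 i), ← Real.rpow_add (hR0 i),
        show -(2 + γ + β) + (1 + γ + β + 1) = 0 by ring, Real.rpow_zero]
    calc R i ^ (-(2 + γ + β)) * (C₁ * R i ^ (1 + γ + β) * (Real.sqrt (25 * π) * R i * 2))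
        = D * (R i ^ (-(2 + γ + β)) * (R i ^ (1 + γ + β) * R i)) := by rw [hD]; ring
      _ = D := by rw [h3, mul_one]
  obtain ⟨i, hi⟩ := hfu (D + ∑ j ∈ Finset.range i₀,
    ‖∑ k ∈ Finset.Ico (M j) (N j), w j k * f (l k)‖)
  have hsum0 : 0 ≤ ∑ j ∈ Finset.range i₀, ‖∑ k ∈ Finset.Ico (M j) (N j), w j k * f (l k)‖ :=
    Finset.sum_nonneg fun _ _ => norm_nonneg _
  rcases lt_or_ge i i₀ with h | h
  · have := Finset.single_le_sum
      (f := fun j => ‖∑ k ∈ Finset.Ico (M j) (N j), w j k * f (l k)‖)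
      (fun _ _ => norm_nonneg _) (Finset.mem_range.2 h)
    linarith
  · linarith [hbound i h]
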